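/- Let $\mathcal{E}$ be an elementary topos (with chosen finite products) and $(Q,\otimes,k,\bigvee)$ an internal commutative quantale in $\mathcal{E}$. *Relations.* A $Q$-relation $A\to B$ is a morphism $R:A\times B\to Q$. In the internal language, identities are $1_A(a,a')=\bigvee\{k\mid a=a'\}$, composition is $(S\circ R)(a,c)=\bigvee_b R(a,b)\otimes S(b,c)$, and the tensor of morphisms is $(R\otimes R')((a,a'),(b,b'))=R(a,b)\otimes R'(a',b')$. For a signature $\Sigma$ of finitary operation symbols with a set $E$ of equations, a $Q$-relation between the carriers of two $(\Sigma,E)$-algebras in $\mathcal{E}$ is algebraic if $R(a_1,b_1)\otimes\dots\otimes R(a_n,b_n)\le R(\sigma(a_1,\dots,a_n),\sigma(b_1,\dots,b_n))$ for every $n$-ary $\sigma\in\Sigma$. It is affine if $R(a_1,b_1)\otimes R(a_2,b_2)\le R(a_1,b_1)$, relevant if $R(a,b)\le R(a,b)\otimes R(a,b)$, cartesian if affine and relevant, and linear without further condition. For each $\kappa\in\{\text{linear, affine, relevant, cartesian}\}$, let $\mathbf{Rel}^\kappa_{(\Sigma,E)}(Q)$ be the category of $(\Sigma,E)$-algebras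 and algebraic $Q$-relations of kind $\kappa$. It is monoidal: the tensor of objects is the product of algebras, the unit is the terminal algebra, and the coherence isomorphisms are the graphs $f_\circ(a,b)=\bigvee\{k\mid f(a)=b\}$ of those of $\mathcal{E}$. *Interpretations.* A term over a finite set of variables is linear (affine, relevant, cartesian) if it uses each of these variables exactly once (at most once, at least once, without restriction). An interpretation $i:(\Sigma_1,E_1)\to(\Sigma_2,E_2)$ of kind $\kappa$ assigns to each $\sigma\in\Sigma_1$ a term $i(\sigma)$ over $\Sigma_2$ of the same arity and of kind $\kappa$, such that the translations of the equations $E_1$ are provable from $E_2$ in equational logic. Signatures with equations and interpretations of kind $\kappa$ form a category, with composition by substitution. **Theorem.** Let $\kappa$ be any of the four kinds. Every interpretation $i:(\Sigma_1,E_1)\to(\Sigma_2,E_2)$ of kind $\kappa$ induces a strict monoidal functor $$i^*:\mathbf{Rel}^\kappa_{(\Sigma_2,E_2)}(Q)\to\mathbf{Rel}^\kappa_{(\Sigma_1,E_1)}(Q)$$ which sends an algebra $A$ to the algebra with the same carrier in which each $\sigma\in\Sigma_1$ is interpreted by the derived operation of $i(\sigma)$ in $A$, and which is the identity on underlying $Q$-relations.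 The assignment $i\mapsto i^*$ is contravariantly functorial: $(\mathrm{id})^*=\mathrm{id}$ and $(j\circ i)^*=i^*\circ j^*$. Moreover, every algebraic $Q$-relation $R:A\to B$ of kind $\kappa$ over any $(\Sigma,E)$ respects derived operations of kind $\kappa$: for every term $\tau$ of kind $\kappa$ in $n$ variables, $$R(a_1,b_1)\otimes\dots\otimes R(a_n,b_n)\le R(\tau(a_1,\dots,a_n),\tau(b_1,\dots,b_n)).$$ -/

import Mathlib

open CategoryTheory Category Limits MonoidalCategory CartesianMonoidalCategory
open scoped MonObj

universe w v u

set_option linter.unusedSectionVars false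

namespace QRel

noncomputable section

/-! ### Internal language of an elementary topos

The base category `E` is an elementary topos: it has chosen finite products, finite limits,
exponentials and a subobject classifier.  A formula in context `X` is a morphism `X ⟶ Ω`;
it is valid at stage `X` when it equals "true". -/

section Logic

variable {E : Type u} [Category.{v} E] [HasSubobjectClassifier E]

/-- The truth values object. -/
abbrev Om (E : Type u) [Category.{v} E] [HasSubobjectClassifier E] : E :=
  HasSubobjectClassifier.Ω E

/-- The formula "true" in context `X`. -/
def tt (X : E) : X ⟶ Om E :=
  Subobject.Classifier.χ₀ _ X ≫ HasSubobjectClassifier.truth E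

/-- Validity of a formula in context `X`. -/
def Holds {X : E} (φ : X ⟶ Om E) : Prop := φ = tt X

theorem comp_tt {X Y : E} (y : Y ⟶ X) : y ≫ tt X = tt Y := by
  unfold tt
  rw [← assoc]
  congr 1
  exact Subsingleton.elim _ _

theorem Holds.comp {X Y : E} {φ : X ⟶ Om E} (h : Holds φ) (y : Y ⟶ X) : Holds (y ≫ φ) := by
  unfold Holds at *
  rw [h, comp_tt]

theorem holds_χ_iff {U X Y : E} (m : U ⟶ X) [Mono m] (y : Y ⟶ X) :
    Holds (y ≫ HasSubobjectClassifier.χ m) ↔ ∃ l : Y ⟶ U, l ≫ m = y := by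
  constructor
  · intro h
    exact ⟨(HasSubobjectClassifier.isPullback_χ m).lift y (Subobject.Classifier.χ₀ _ Y) h,
      IsPullback.lift_fst _ _ _ _⟩
  · rintro ⟨l, rfl⟩
    have h : Holds (m ≫ HasSubobjectClassifier.χ m) :=
      (HasSubobjectClassifier.isPullback_χ m).w
    rw [assoc]
    exact h.comp l

theorem omega_ext [HasPullbacks E] {X : E} {φ ψ : X ⟶ Om E}
    (h : ∀ {Y : E} (y : Y ⟶ X), Holds (y ≫ φ) ↔ Holds (y ≫ ψ)) : φ = ψ := by
  obtain ⟨Z, i, hi, rfl⟩ := Subobject.Classifier.surjective_χ _ φ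
  obtain ⟨W, j, hj, rfl⟩ := Subobject.Classifier.surjective_χ _ ψ
  obtain ⟨a, ha⟩ := (holds_χ_iff j i).1 ((h i).1 ((holds_χ_iff i i).2 ⟨𝟙 _, id_comp _⟩))
  obtain ⟨b, hb⟩ := (holds_χ_iff i j).1 ((h j).2 ((holds_χ_iff j j).2 ⟨𝟙 _, id_comp _⟩))
  have hab : a ≫ b = 𝟙 Z := by rw [← cancel_mono i, assoc, hb, ha, id_comp]
  have hba : b ≫ a = 𝟙 W := by rw [← cancel_mono j, assoc, ha, hb, id_comp]
  refine HasSubobjectClassifier.unique j _ ?_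
  refine IsPullback.of_iso (HasSubobjectClassifier.isPullback_χ i) ⟨a, b, hab, hba⟩
    (Iso.refl _) (Iso.refl _) (Iso.refl _) ?_ ?_ ?_ ?_
  · simp [ha]
  · exact Subsingleton.elim _ _
  · simp; rfl
  · simp

variable [HasFiniteLimits E]

/-- The formula `f = g`. -/
def eqF {X Y : E} (f g : X ⟶ Y) : X ⟶ Om E :=
  HasSubobjectClassifier.χ (equalizer.ι f g)

theorem holds_eqF {X Y Z : E} (f g : X ⟶ Y) (z : Z ⟶ X) :
    Holds (z ≫ eqF f g) ↔ z ≫ f = z ≫ g := by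
  rw [eqF, holds_χ_iff]
  constructor
  · rintro ⟨l, rfl⟩
    rw [assoc, assoc, equalizer.condition]
  · intro h
    exact ⟨equalizer.lift z h, equalizer.lift_ι _ _⟩

variable [CartesianMonoidalCategory E]

/-- Conjunction `φ ∧ ψ`, as `(φ, ψ) = (true, true)`. -/
def andF {X : E} (φ ψ : X ⟶ Om E) : X ⟶ Om E :=
  eqF (lift φ ψ) (lift (tt X) (tt X))

theorem holds_andF {X Z : E} (φ ψ : X ⟶ Om E) (z : Z ⟶ X) :
    Holds (z ≫ andF φ ψ) ↔ Holds (z ≫ φ) ∧ Holds (z ≫ ψ) := by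
  rw [andF, holds_eqF, comp_lift, comp_lift, comp_tt]
  constructor
  · intro h
    have h₁ := h =≫ fst _ _
    have h₂ := h =≫ snd _ _
    simp only [lift_fst, lift_snd] at h₁ h₂
    exact ⟨h₁, h₂⟩
  · rintro ⟨h₁, h₂⟩
    rw [h₁, h₂]

/-- Implication `φ ⇒ ψ`, as `(φ ∧ ψ) = φ`. -/
def impF {X : E} (φ ψ : X ⟶ Om E) : X ⟶ Om E :=
  eqF (andF φ ψ) φ

theorem holds_impF {X Z : E} (φ ψ : X ⟶ Om E) (z : Z ⟶ X) :
    Holds (z ≫ impF φ ψ) ↔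
      ∀ {Y : E} (y : Y ⟶ Z), Holds (y ≫ z ≫ φ) → Holds (y ≫ z ≫ ψ) := by
  rw [impF, holds_eqF]
  constructor
  · intro h Y y hy
    rw [← h, ← assoc, holds_andF] at hy
    simpa using hy.2
  · intro h
    apply omega_ext
    intro Y y
    have := h y
    rw [← assoc, holds_andF, assoc, assoc]
    tauto

variable [MonoidalClosed E]

/-- Universal quantification `∀ z : Z, φ(z, x)`. -/
def allF (Z : E) {X : E} (φ : Z ⊗ X ⟶ Om E) : X ⟶ Om E :=
  eqF (MonoidalClosed.curry φ) (MonoidalClosed.curry (tt (Z ⊗ X)))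

theorem holds_allF {Z X W : E} (φ : Z ⊗ X ⟶ Om E) (x : W ⟶ X) :
    Holds (x ≫ allF Z φ) ↔
      ∀ {Y : E} (y : Y ⟶ W) (z : Y ⟶ Z), Holds (lift z (y ≫ x) ≫ φ) := by
  rw [allF, holds_eqF, ← MonoidalClosed.curry_natural_left, ← MonoidalClosed.curry_natural_left,
    MonoidalClosed.curry_injective.eq_iff, comp_tt]
  constructor
  · intro h Y y z
    have := Holds.comp (φ := Z ◁ x ≫ φ) h (lift z y)
    simpa using this
  · intro h
    have := h (snd Z W) (fst Z W)
    have e : lift (fst Z W) (snd Z W ≫ x) = Z ◁ x := by ext <;> simp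
    rwa [e] at this

/-- Existential quantification `∃ z : Z, φ(z, x)`, by the usual second order encoding
`∀ w : Ω, (∀ z : Z, φ(z, x) ⇒ w) ⇒ w`. -/
def exF (Z : E) {X : E} (φ : Z ⊗ X ⟶ Om E) : X ⟶ Om E :=
  allF (Om E) (impF
    (allF Z (impF ((Z ◁ snd (Om E) X) ≫ φ) (snd Z (Om E ⊗ X) ≫ fst (Om E) X)))
    (fst (Om E) X))

theorem holds_exF {Z X W : E} (φ : Z ⊗ X ⟶ Om E) (x : W ⟶ X) :
    Holds (x ≫ exF Z φ) ↔ ∀ {Y : E} (y : Y ⟶ W) (p : Y ⟶ Om E),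
      (∀ {V : E} (s : V ⟶ Y) (z : V ⟶ Z),
        Holds (lift z (s ≫ y ≫ x) ≫ φ) → Holds (s ≫ p)) → Holds p := by
  rw [exF, holds_allF]
  simp only [holds_impF]
  constructor
  · intro h Y y p hp
    have := h y p (𝟙 _) ?_
    · simpa using this
    · rw [← assoc, holds_allF]
      intro V s z
      rw [holds_impF]
      intro V' t ht
      have := hp (t ≫ s) (t ≫ z) (by simpa [comp_lift_assoc] using ht)
      simpa [comp_lift_assoc] using this
  · intro h Y y p V s hs
    rw [← assoc, holds_allF] at hs
    simp only [holds_impF] at hs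
    have := h (s ≫ y) (s ≫ p) ?_
    · simpa using this
    · intro V' t z hz
      have := hs t z (𝟙 _) (by simpa [comp_lift_assoc] using hz)
      simpa [comp_lift_assoc] using this

end Logic

/-! ### Internal quantales -/

section Quantale

variable {E : Type u} [Category.{v} E] [CartesianMonoidalCategory E] [HasFiniteLimits E]
  [MonoidalClosed E] [HasSubobjectClassifier E]

/-- The power object of `Q`. -/
abbrev PowObj (Q : E) : E := (ihom Q).obj (Om E)

/-- A subset of `Q` in context `X` is given by its membership predicate `S : Q ⊗ X ⟶ Ω`,
equivalently by the generalized element `curry S` of the power object. -/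
abbrev SubsetIn (Q X : E) := Q ⊗ X ⟶ Om E

/-- The subset `{a ⊗ b | b ∈ S}` of `Q`. -/
def mulLeftSet {Q : E} [MonObj Q] {X : E} (a : X ⟶ Q) (S : SubsetIn Q X) : SubsetIn Q X :=
  exF Q (andF ((Q ◁ snd Q X) ≫ S)
    (eqF (snd Q (Q ⊗ X) ≫ fst Q X) ((snd Q (Q ⊗ X) ≫ snd Q X ≫ a) * fst Q (Q ⊗ X))))

/-- The subset `{b ⊗ a | b ∈ S}` of `Q`. -/
def mulRightSet {Q : E} [MonObj Q] {X : E} (S : SubsetIn Q X) (a : X ⟶ Q) : SubsetIn Q X :=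
  exF Q (andF ((Q ◁ snd Q X) ≫ S)
    (eqF (snd Q (Q ⊗ X) ≫ fst Q X) (fst Q (Q ⊗ X) * (snd Q (Q ⊗ X) ≫ snd Q X ≫ a))))

/-- An internal quantale in the topos `E`: an internal monoid with an internal partial order,
an internal join operation `⋁ : P(Q) ⟶ Q` giving the least upper bound of every subset, over
which multiplication distributes on both sides.  Axioms in the internal language are written
out by their meaning for generalized elements at an arbitrary stage. -/
class InternalQuantale (Q : E) [MonObj Q] where
  /-- the order relation -/
  le : Q ⊗ Q ⟶ Om E
  /-- the join operation -/
  sup : PowObj Q ⟶ Q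
  le_refl : ∀ {X : E} (p : X ⟶ Q), Holds (lift p p ≫ le)
  le_trans : ∀ {X : E} (p q r : X ⟶ Q),
    Holds (lift p q ≫ le) → Holds (lift q r ≫ le) → Holds (lift p r ≫ le)
  le_antisymm : ∀ {X : E} (p q : X ⟶ Q),
    Holds (lift p q ≫ le) → Holds (lift q p ≫ le) → p = q
  sup_le_iff : ∀ {X : E} (S : SubsetIn Q X) (t : X ⟶ Q),
    Holds (lift (MonoidalClosed.curry S ≫ sup) t ≫ le) ↔
      ∀ {Y : E} (y : Y ⟶ X) (q : Y ⟶ Q),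
        Holds (lift q y ≫ S) → Holds (lift q (y ≫ t) ≫ le)
  mul_sup : ∀ {X : E} (a : X ⟶ Q) (S : SubsetIn Q X),
    a * (MonoidalClosed.curry S ≫ sup) = MonoidalClosed.curry (mulLeftSet a S) ≫ sup
  sup_mul : ∀ {X : E} (S : SubsetIn Q X) (a : X ⟶ Q),
    (MonoidalClosed.curry S ≫ sup) * a = MonoidalClosed.curry (mulRightSet S a) ≫ sup

variable {Q : E} [MonObj Q] [InternalQuantale Q]

/-- Generalized elements of `Q` at stage `X`, ordered by internal validity of `p ≤ q`. -/
instance homPartialOrder (X : E) : PartialOrder (X ⟶ Q) where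
  le p q := Holds (lift p q ≫ InternalQuantale.le)
  le_refl := InternalQuantale.le_refl
  le_trans := InternalQuantale.le_trans
  le_antisymm := InternalQuantale.le_antisymm

/-- The join `⋁ S` of a subset in context. -/
def join {X : E} (S : SubsetIn Q X) : X ⟶ Q := MonoidalClosed.curry S ≫ InternalQuantale.sup

/-- The join `⋁ { F(b, x) | b : B }`, i.e. `⋁ { q | ∃ b : B, q = F(b, x) }`. -/
def joinFam {B X : E} (F : B ⊗ X ⟶ Q) : X ⟶ Q :=
  join (exF B (eqF (snd B (Q ⊗ X) ≫ fst Q X) ((B ◁ snd Q X) ≫ F)))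

theorem comp_mono {X Y : E} {p q : X ⟶ Q} (h : p ≤ q) (y : Y ⟶ X) : y ≫ p ≤ y ≫ q := by
  have : Holds (y ≫ lift p q ≫ InternalQuantale.le) := Holds.comp h y
  rw [← assoc, comp_lift] at this
  exact this

theorem join_le_iff {X : E} (S : SubsetIn Q X) (t : X ⟶ Q) :
    join S ≤ t ↔ ∀ {Y : E} (y : Y ⟶ X) (q : Y ⟶ Q), Holds (lift q y ≫ S) → q ≤ y ≫ t :=
  InternalQuantale.sup_le_iff S t

theorem comp_join {X Y : E} (y : Y ⟶ X) (S : SubsetIn Q X) :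
    y ≫ join S = join ((Q ◁ y) ≫ S) := by
  rw [join, join, MonoidalClosed.curry_natural_left, assoc]

theorem holds_le {X Y : E} (y : Y ⟶ X) (p q : X ⟶ Q) :
    Holds (y ≫ lift p q ≫ InternalQuantale.le) ↔ y ≫ p ≤ y ≫ q := by
  rw [← assoc, comp_lift]; rfl

theorem mul_join_le_iff {X Y : E} (y : Y ⟶ X) (S : SubsetIn Q X) (u t : Y ⟶ Q) :
    u * (y ≫ join S) ≤ t ↔
      ∀ {Z : E} (z : Z ⟶ Y) (q : Z ⟶ Q), Holds (lift q (z ≫ y) ≫ S) → (z ≫ u) * q ≤ z ≫ t := by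
  have e : u * (y ≫ join S) = join (mulLeftSet u ((Q ◁ y) ≫ S)) := by
    rw [comp_join]; exact InternalQuantale.mul_sup _ _
  rw [e, join_le_iff]
  simp only [mulLeftSet, holds_exF, holds_andF, holds_eqF]
  constructor
  · intro h Z z q hq
    refine h z _ ?_
    intro V v p hp
    have := hp (𝟙 _) (v ≫ q) ⟨?_, ?_⟩
    · simpa using this
    · have := Holds.comp hq v
      simpa [comp_lift_assoc] using this
    · simp [MonObj.comp_mul]
  · intro h Z z q hq
    refine hq (𝟙 _) (lift q (z ≫ t) ≫ InternalQuantale.le) ?_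
    rintro V v r ⟨h₁, h₂⟩
    rw [holds_le]
    have := h (v ≫ z) r (by simpa using h₁)
    simp [MonObj.comp_mul] at h₂
    rw [h₂]
    simpa using this

theorem mul_joinFam_le_iff {B X Y : E} (y : Y ⟶ X) (F : B ⊗ X ⟶ Q) (u t : Y ⟶ Q) :
    u * (y ≫ joinFam F) ≤ t ↔
      ∀ {Z : E} (z : Z ⟶ Y) (b : Z ⟶ B), (z ≫ u) * (lift b (z ≫ y) ≫ F) ≤ z ≫ t := by
  rw [joinFam, mul_join_le_iff]
  simp only [holds_exF, holds_eqF]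
  constructor
  · intro h Z z b
    refine h z _ ?_
    intro V v p hp
    have := hp (𝟙 _) (v ≫ b) (by simp [comp_lift_assoc])
    simpa using this
  · intro h Z z q hq
    refine hq (𝟙 _) (lift ((z ≫ u) * q) (z ≫ t) ≫ InternalQuantale.le) ?_
    intro V v b hb
    rw [holds_le]
    have := h (v ≫ z) b
    simp at hb
    rw [MonObj.comp_mul, hb]
    simpa using this

theorem mul_mono_right {X : E} (u : X ⟶ Q) {p q : X ⟶ Q} (h : p ≤ q) : u * p ≤ u * q := by
  -- `q` is the join of the elements below it
  have hq : q = join (lift (fst Q X) (snd Q X ≫ q) ≫ InternalQuantale.le) := by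
    apply le_antisymm
    · have := (join_le_iff (lift (fst Q X) (snd Q X ≫ q) ≫ InternalQuantale.le) _).1
        le_rfl (𝟙 X) q
        (by
          have : Holds (lift q q ≫ InternalQuantale.le) := le_refl q
          simpa [comp_lift_assoc] using this)
      simpa using this
    · rw [join_le_iff]
      intro Y y r hr
      rw [← assoc, comp_lift] at hr
      simpa using! hr
  have h1 := (mul_join_le_iff (𝟙 X) (lift (fst Q X) (snd Q X ≫ q) ≫ InternalQuantale.le)
    u (u * q)).1 (by rw [id_comp, ← hq]) (𝟙 X) p (by
      have : Holds (lift p q ≫ InternalQuantale.le) := h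
      simpa [comp_lift_assoc] using this)
  simpa using h1

end Quantale

/-! ### The category of `Q`-relations -/

section Relations

variable {E : Type u} [Category.{v} E] [CartesianMonoidalCategory E] [BraidedCategory E]
  [HasFiniteLimits E] [MonoidalClosed E] [HasSubobjectClassifier E]
variable {Q : E} [MonObj Q] [IsCommMonObj Q] [InternalQuantale Q]

theorem mul_mono {X : E} {p q p' q' : X ⟶ Q} (h : p ≤ q) (h' : p' ≤ q') :
    p * p' ≤ q * q' := by
  refine (mul_mono_right p h').trans ?_
  rw [mul_comm p, mul_comm q]
  exact mul_mono_right q' h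

/-- A `Q`-relation is a morphism `R : A ⊗ B ⟶ Q`; this is its value `R(a, b)` at generalized
elements `a` and `b`. -/
def ev {A B X : E} (R : A ⊗ B ⟶ Q) (a : X ⟶ A) (b : X ⟶ B) : X ⟶ Q := lift a b ≫ R

theorem comp_ev {A B X Y : E} (R : A ⊗ B ⟶ Q) (a : X ⟶ A) (b : X ⟶ B) (y : Y ⟶ X) :
    y ≫ ev R a b = ev R (y ≫ a) (y ≫ b) := by
  simp [ev, comp_lift_assoc]

theorem rel_ext {A B : E} {R S : A ⊗ B ⟶ Q}
    (h : ∀ {X : E} (a : X ⟶ A) (b : X ⟶ B), ev R a b = ev S a b) : R = S := by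
  have := h (fst A B) (snd A B)
  simpa [ev] using this

/-- Identity relation: `1_A(a₁, a₂) = ⋁ { k | a₁ = a₂ }`, where `k` is the unit of `Q`. -/
def idRel (Q : E) [MonObj Q] [InternalQuantale Q] (A : E) : A ⊗ A ⟶ Q :=
  join (andF
    (eqF (fst Q (A ⊗ A)) 1)
    (eqF (snd Q (A ⊗ A) ≫ fst A A) (snd Q (A ⊗ A) ≫ snd A A)))

/-- Composition: `(S ∘ R)(a, c) = ⋁_b R(a, b) ⊗ S(b, c)`. -/
def compRel {A B C : E} (R : A ⊗ B ⟶ Q) (S : B ⊗ C ⟶ Q) : A ⊗ C ⟶ Q :=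
  joinFam (B := B) (X := A ⊗ C)
    (ev R (snd B (A ⊗ C) ≫ fst A C) (fst B (A ⊗ C)) *
      ev S (fst B (A ⊗ C)) (snd B (A ⊗ C) ≫ snd A C))

/-- Tensor: `(R ⊗ R')((a, a'), (b, b')) = R(a, b) ⊗ R'(a', b')`. -/
def tensorRel {A B A' B' : E} (R : A ⊗ B ⟶ Q) (R' : A' ⊗ B' ⟶ Q) :
    (A ⊗ A') ⊗ (B ⊗ B') ⟶ Q :=
  ev R (fst (A ⊗ A') (B ⊗ B') ≫ fst A A') (snd (A ⊗ A') (B ⊗ B') ≫ fst B B') *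
    ev R' (fst (A ⊗ A') (B ⊗ B') ≫ snd A A') (snd (A ⊗ A') (B ⊗ B') ≫ snd B B')

/-- Graph of a morphism: `f_∘(a, b) = ⋁ { k | f(a) = b }`. -/
def graphRel (Q : E) [MonObj Q] [InternalQuantale Q] {A B : E} (f : A ⟶ B) : A ⊗ B ⟶ Q :=
  ev (idRel Q B) (fst A B ≫ f) (snd A B)

theorem ev_tensorRel {A B A' B' X : E} (R : A ⊗ B ⟶ Q) (R' : A' ⊗ B' ⟶ Q)
    (a : X ⟶ A ⊗ A') (b : X ⟶ B ⊗ B') :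
    ev (tensorRel R R') a b =
      ev R (a ≫ fst _ _) (b ≫ fst _ _) * ev R' (a ≫ snd _ _) (b ≫ snd _ _) := by
  simp [ev, tensorRel, MonObj.comp_mul]

theorem ev_graphRel {A B X : E} (f : A ⟶ B) (a : X ⟶ A) (b : X ⟶ B) :
    ev (graphRel Q f) a b = ev (idRel Q B) (a ≫ f) b := by
  simp [ev, graphRel, comp_lift_assoc]

theorem mul_idRel_le_iff {A X : E} (a b : X ⟶ A) (u t : X ⟶ Q) :
    u * ev (idRel Q A) a b ≤ t ↔
      ∀ {Z : E} (z : Z ⟶ X), z ≫ a = z ≫ b → z ≫ u ≤ z ≫ t := by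
  rw [ev, idRel, mul_join_le_iff]
  simp only [holds_andF, holds_eqF]
  constructor
  · intro h Z z hz
    have := h z 1 ⟨?_, ?_⟩
    · simpa using this
    · simp
    · simp [hz]
  · rintro h Z z q ⟨h₁, h₂⟩
    simp only [lift_fst, MonObj.comp_one] at h₁
    rw [h₁, mul_one]
    exact h z (by simpa [comp_lift_assoc] using h₂)

theorem mul_compRel_le_iff {A B C X : E} (R : A ⊗ B ⟶ Q) (S : B ⊗ C ⟶ Q)
    (a : X ⟶ A) (c : X ⟶ C) (u t : X ⟶ Q) :
    u * ev (compRel R S) a c ≤ t ↔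
      ∀ {Z : E} (z : Z ⟶ X) (b : Z ⟶ B),
        (z ≫ u) * (ev R (z ≫ a) b * ev S b (z ≫ c)) ≤ z ≫ t := by
  have e : ∀ {Z : E} (z : Z ⟶ X) (b : Z ⟶ B),
      lift b (z ≫ lift a c) ≫ (ev R (snd B (A ⊗ C) ≫ fst A C) (fst B (A ⊗ C)) *
        ev S (fst B (A ⊗ C)) (snd B (A ⊗ C) ≫ snd A C)) =
      ev R (z ≫ a) b * ev S b (z ≫ c) := by
    intro Z z b
    simp [MonObj.comp_mul, comp_ev]
  rw [ev, compRel, mul_joinFam_le_iff]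
  simp only [e]

theorem compRel_le_iff {A B C X : E} (R : A ⊗ B ⟶ Q) (S : B ⊗ C ⟶ Q)
    (a : X ⟶ A) (c : X ⟶ C) (t : X ⟶ Q) :
    ev (compRel R S) a c ≤ t ↔
      ∀ {Z : E} (z : Z ⟶ X) (b : Z ⟶ B), ev R (z ≫ a) b * ev S b (z ≫ c) ≤ z ≫ t := by
  have := mul_compRel_le_iff R S a c 1 t
  simpa [MonObj.comp_one] using this

theorem idRel_le_iff {A X : E} (a b : X ⟶ A) (t : X ⟶ Q) :
    ev (idRel Q A) a b ≤ t ↔ ∀ {Z : E} (z : Z ⟶ X), z ≫ a = z ≫ b → 1 ≤ z ≫ t := by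
  have := mul_idRel_le_iff a b 1 t
  simpa [MonObj.comp_one] using this

theorem one_le_idRel {A X : E} (a : X ⟶ A) : 1 ≤ ev (idRel Q A) a a := by
  have := (idRel_le_iff a a _).1 (le_refl (ev (idRel Q A) a a)) (𝟙 X) rfl
  simpa using this

theorem graphRel_comp_ev {A B C X : E} (f : A ⟶ B) (R : B ⊗ C ⟶ Q) (a : X ⟶ A) (c : X ⟶ C) :
    ev (compRel (graphRel Q f) R) a c = ev R (a ≫ f) c := by
  apply eq_of_forall_ge_iff
  intro t
  rw [compRel_le_iff]
  constructor
  · intro h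
    have := h (𝟙 X) (a ≫ f)
    rw [ev_graphRel, mul_comm, mul_idRel_le_iff] at this
    simpa using this (𝟙 X) (by simp)
  · intro h Z z b
    rw [ev_graphRel, mul_comm, mul_idRel_le_iff]
    intro W w hw
    rw [comp_ev, ← hw]
    simpa [comp_ev] using comp_mono h (w ≫ z)

theorem comp_graphRel_ev {A B C X : E} (e : B ≅ C) (R : A ⊗ B ⟶ Q) (a : X ⟶ A) (c : X ⟶ C) :
    ev (compRel R (graphRel Q e.hom)) a c = ev R a (c ≫ e.inv) := by
  apply eq_of_forall_ge_iff
  intro t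
  rw [compRel_le_iff]
  constructor
  · intro h
    have := h (𝟙 X) (c ≫ e.inv)
    rw [ev_graphRel, mul_idRel_le_iff] at this
    simpa using this (𝟙 X) (by simp)
  · intro h Z z b
    rw [ev_graphRel, mul_idRel_le_iff]
    intro W w hw
    have hb : w ≫ b = w ≫ z ≫ c ≫ e.inv := by
      have := hw =≫ e.inv
      simpa using this
    rw [comp_ev, hb]
    simpa [comp_ev] using comp_mono h (w ≫ z)

theorem graphRel_id (A : E) : graphRel Q (𝟙 A) = idRel Q A := by
  apply rel_ext
  intro X a b
  rw [ev_graphRel, comp_id]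

theorem id_compRel {A B : E} (R : A ⊗ B ⟶ Q) : compRel (idRel Q A) R = R := by
  apply rel_ext
  intro X a b
  rw [← graphRel_id, graphRel_comp_ev, comp_id]

theorem compRel_id {A B : E} (R : A ⊗ B ⟶ Q) : compRel R (idRel Q B) = R := by
  apply rel_ext
  intro X a b
  have := comp_graphRel_ev (Iso.refl B) R a b
  simpa [graphRel_id] using this

theorem compRel_assoc {A B C D : E} (R : A ⊗ B ⟶ Q) (S : B ⊗ C ⟶ Q) (T : C ⊗ D ⟶ Q) :
    compRel (compRel R S) T = compRel R (compRel S T) := by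
  apply rel_ext
  intro X a d
  apply eq_of_forall_ge_iff
  intro t
  rw [compRel_le_iff, compRel_le_iff]
  constructor
  · intro h Z z b
    rw [mul_compRel_le_iff]
    intro W w c
    have := h (w ≫ z) c
    rw [mul_comm, mul_compRel_le_iff] at this
    have := this (𝟙 W) (w ≫ b)
    rw [comp_ev, ← mul_assoc]
    rw [mul_comm] at this
    simpa using this
  · intro h Z z c
    rw [mul_comm, mul_compRel_le_iff]
    intro W w b
    have := h (w ≫ z) b
    rw [mul_compRel_le_iff] at this
    have := this (𝟙 W) (w ≫ c)
    rw [comp_ev, mul_comm, mul_assoc]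
    simpa using this

theorem tensorRel_id (A B : E) :
    tensorRel (idRel Q A) (idRel Q B) = idRel Q (A ⊗ B) := by
  apply rel_ext
  intro X a b
  apply eq_of_forall_ge_iff
  intro t
  rw [ev_tensorRel, mul_idRel_le_iff, idRel_le_iff]
  constructor
  · intro h Z z hz
    have h1 := h z (by rw [← assoc, hz, assoc])
    refine le_trans ?_ h1
    rw [comp_ev, ← assoc, hz, assoc]
    exact one_le_idRel _
  · intro h Z z hz
    rw [comp_ev, idRel_le_iff]
    intro W w hw
    have := h (w ≫ z) (by
      apply hom_ext
      · simpa using hw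
      · simpa using w ≫= hz)
    simpa using this

theorem tensorRel_comp {A B C A' B' C' : E} (R : A ⊗ B ⟶ Q) (S : B ⊗ C ⟶ Q)
    (R' : A' ⊗ B' ⟶ Q) (S' : B' ⊗ C' ⟶ Q) :
    compRel (tensorRel R R') (tensorRel S S') = tensorRel (compRel R S) (compRel R' S') := by
  apply rel_ext
  intro X a c
  apply eq_of_forall_ge_iff
  intro t
  rw [ev_tensorRel, compRel_le_iff, mul_compRel_le_iff]
  constructor
  · intro h Z z b'
    rw [comp_ev, mul_comm, mul_compRel_le_iff]
    intro W w b
    have := h (w ≫ z) (lift b (w ≫ b'))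
    rw [ev_tensorRel, ev_tensorRel] at this
    rw [MonObj.comp_mul, comp_ev, comp_ev, mul_comm, mul_mul_mul_comm]
    simpa using this
  · intro h Z z b
    have := h z (b ≫ snd _ _)
    rw [comp_ev, mul_comm, mul_compRel_le_iff] at this
    have := this (𝟙 Z) (b ≫ fst _ _)
    rw [ev_tensorRel, ev_tensorRel, mul_mul_mul_comm, mul_comm]
    simpa using this

theorem graphRel_comp {A B C : E} (f : A ⟶ B) (g : B ⟶ C) :
    graphRel Q (f ≫ g) = compRel (graphRel Q f) (graphRel Q g) := by
  apply rel_ext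
  intro X a c
  rw [graphRel_comp_ev, ev_graphRel, ev_graphRel, assoc]

theorem tensorRel_graph {A B A' B' : E} (f : A ⟶ B) (g : A' ⟶ B') :
    tensorRel (graphRel Q f) (graphRel Q g) = graphRel Q (f ⊗ₘ g) := by
  apply rel_ext
  intro X a b
  rw [ev_tensorRel, ev_graphRel, ev_graphRel, ev_graphRel, ← tensorRel_id, ev_tensorRel]
  simp

/-- The objects of the category of `Q`-relations are the objects of the topos. -/
structure RelObj (Q : E) where
  /-- the underlying object -/
  obj : E

/-- The category `Rel(Q)` of `Q`-relations; `R ≫ S` is `S ∘ R`. -/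
instance : Category (RelObj Q) where
  Hom A B := A.obj ⊗ B.obj ⟶ Q
  id A := idRel Q A.obj
  comp R S := compRel R S
  id_comp := id_compRel
  comp_id := compRel_id
  assoc := compRel_assoc

/-- The graph of an isomorphism is an isomorphism. -/
def graphIso {A B : E} (e : A ≅ B) : (RelObj.mk A : RelObj Q) ≅ RelObj.mk B where
  hom := graphRel Q e.hom
  inv := graphRel Q e.inv
  hom_inv_id := by
    change compRel _ _ = idRel Q A
    rw [← graphRel_comp, e.hom_inv_id, graphRel_id]
  inv_hom_id := by
    change compRel _ _ = idRel Q B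
    rw [← graphRel_comp, e.inv_hom_id, graphRel_id]

/-- The tensor product is given by the chosen products of the topos, and the coherence
isomorphisms are the graphs of those of the topos. -/
instance : MonoidalCategoryStruct (RelObj Q) where
  tensorObj A B := ⟨A.obj ⊗ B.obj⟩
  tensorUnit := ⟨𝟙_ E⟩
  tensorHom R S := tensorRel R S
  whiskerLeft A _ _ R := tensorRel (idRel Q A.obj) R
  whiskerRight R A := tensorRel R (idRel Q A.obj)
  associator A B C := graphIso (α_ A.obj B.obj C.obj)
  leftUnitor A := graphIso (λ_ A.obj)
  rightUnitor A := graphIso (ρ_ A.obj)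

instance : MonoidalCategory (RelObj Q) := MonoidalCategory.ofTensorHom
  (id_tensorHom_id := fun A B => tensorRel_id A.obj B.obj)
  (id_tensorHom := fun _ _ _ _ => rfl)
  (tensorHom_id := fun _ _ => rfl)
  (tensorHom_comp_tensorHom := fun R R' S S' => tensorRel_comp R S R' S')
  (associator_naturality := fun {A₁ A₂ A₃ B₁ B₂ B₃} R₁ R₂ R₃ => by
    change compRel (tensorRel (tensorRel R₁ R₂) R₃) (graphRel Q (α_ B₁.obj B₂.obj B₃.obj).hom) =
      compRel (graphRel Q (α_ A₁.obj A₂.obj A₃.obj).hom) (tensorRel R₁ (tensorRel R₂ R₃))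
    apply rel_ext
    intro X a b
    rw [comp_graphRel_ev, graphRel_comp_ev]
    simp [ev_tensorRel, mul_assoc])
  (leftUnitor_naturality := fun {A B} R => by
    change compRel (tensorRel (idRel Q (𝟙_ E)) R) (graphRel Q (λ_ B.obj).hom) =
      compRel (graphRel Q (λ_ A.obj).hom) R
    apply rel_ext
    intro X a b
    rw [comp_graphRel_ev, graphRel_comp_ev, ev_tensorRel]
    have h : ev (idRel Q (𝟙_ E)) (a ≫ fst _ _) ((b ≫ (λ_ B.obj).inv) ≫ fst _ _) = 1 := by
      apply le_antisymm
      · rw [idRel_le_iff]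
        intro Z z _
        rw [MonObj.comp_one]
      · rw [toUnit_unique ((b ≫ (λ_ B.obj).inv) ≫ fst _ _) (a ≫ fst _ _)]
        exact one_le_idRel _
    rw [h, one_mul, leftUnitor_hom]
    simp)
  (rightUnitor_naturality := fun {A B} R => by
    change compRel (tensorRel R (idRel Q (𝟙_ E))) (graphRel Q (ρ_ B.obj).hom) =
      compRel (graphRel Q (ρ_ A.obj).hom) R
    apply rel_ext
    intro X a b
    rw [comp_graphRel_ev, graphRel_comp_ev, ev_tensorRel]
    have h : ev (idRel Q (𝟙_ E)) (a ≫ snd _ _) ((b ≫ (ρ_ B.obj).inv) ≫ snd _ _) = 1 := by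
      apply le_antisymm
      · rw [idRel_le_iff]
        intro Z z _
        rw [MonObj.comp_one]
      · rw [toUnit_unique ((b ≫ (ρ_ B.obj).inv) ≫ snd _ _) (a ≫ snd _ _)]
        exact one_le_idRel _
    rw [h, mul_one, rightUnitor_hom]
    simp)
  (pentagon := fun A B C D => by
    change compRel (tensorRel (graphRel Q (α_ A.obj B.obj C.obj).hom) (idRel Q D.obj))
        (compRel (graphRel Q (α_ A.obj (B.obj ⊗ C.obj) D.obj).hom)
          (tensorRel (idRel Q A.obj) (graphRel Q (α_ B.obj C.obj D.obj).hom))) =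
      compRel (graphRel Q (α_ (A.obj ⊗ B.obj) C.obj D.obj).hom)
        (graphRel Q (α_ A.obj B.obj (C.obj ⊗ D.obj)).hom)
    simp only [← graphRel_id, tensorRel_graph, ← graphRel_comp]
    simp)
  (triangle := fun A B => by
    change compRel (graphRel Q (α_ A.obj (𝟙_ E) B.obj).hom)
        (tensorRel (idRel Q A.obj) (graphRel Q (λ_ B.obj).hom)) =
      tensorRel (graphRel Q (ρ_ A.obj).hom) (idRel Q B.obj)
    simp only [← graphRel_id, tensorRel_graph, ← graphRel_comp]
    simp)

end Relations

/-! ### Signatures, terms, equational logic and interpretations -/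

/-- A signature: operation symbols with finite arities. -/
structure Signature where
  /-- the operation symbols -/
  Op : Type w
  /-- the arity of an operation symbol -/
  arity : Op → ℕ

/-- Terms over the signature `S` in the variables `x_0, …, x_{n-1}`. -/
inductive Term (S : Signature.{w}) (n : ℕ) : Type w
  | var (i : Fin n) : Term S n
  | op (σ : S.Op) (ts : Fin (S.arity σ) → Term S n) : Term S n

namespace Term

variable {S T U : Signature.{w}}

/-- Simultaneous substitution. -/
def subst {m n : ℕ} (s : Fin m → Term S n) : Term S m → Term S n
  | var i => s i
  | op σ ts => op σ (fun j => (ts j).subst s)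

/-- The number of occurrences of the variable `x_i` in a term. -/
def count {n : ℕ} (i : Fin n) : Term S n → ℕ
  | var j => if j = i then 1 else 0
  | op _ ts => ∑ j, (ts j).count i

/-- Extension of an assignment of derived terms to operation symbols to all terms. -/
def translate (f : ∀ σ : S.Op, Term T (S.arity σ)) {n : ℕ} : Term S n → Term T n
  | var i => var i
  | op σ ts => (f σ).subst (fun j => (ts j).translate f)

theorem subst_var {n : ℕ} (t : Term S n) : t.subst var = t := by
  induction t with
  | var i => rfl
  | op σ ts ih => simp only [subst]; congr; funext j; exact ih j

theorem subst_subst {l m n : ℕ} (s : Fin m → Term S n) (r : Fin l → Term S m) (t : Term S l) :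
    (t.subst r).subst s = t.subst (fun i => (r i).subst s) := by
  induction t with
  | var i => rfl
  | op σ ts ih => simp only [subst]; congr; funext j; exact ih j

theorem translate_subst (f : ∀ σ : S.Op, Term T (S.arity σ)) {m n : ℕ}
    (s : Fin m → Term S n) (t : Term S m) :
    (t.subst s).translate f = (t.translate f).subst (fun i => (s i).translate f) := by
  induction t with
  | var i => rfl
  | op σ ts ih => simp only [subst, translate, subst_subst]; congr; funext j; exact ih j

theorem translate_id {n : ℕ} (t : Term S n) :
    t.translate (fun σ => op σ var) = t := by
  induction t with
  | var i => rfl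
  | op σ ts ih => simp only [translate, subst]; congr; funext j; exact ih j

theorem translate_translate (f : ∀ σ : S.Op, Term T (S.arity σ))
    (g : ∀ σ : T.Op, Term U (T.arity σ)) {n : ℕ} (t : Term S n) :
    (t.translate f).translate g = t.translate (fun σ => (f σ).translate g) := by
  induction t with
  | var i => rfl
  | op σ ts ih => simp only [translate, translate_subst]; congr; funext j; exact ih j

theorem count_subst {m n : ℕ} (s : Fin m → Term S n) (t : Term S m) (i : Fin n) :
    (t.subst s).count i = ∑ j, t.count j * (s j).count i := by
  induction t with
  | var k => simp [subst, count]
  | op σ ts ih =>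
    simp only [subst, count, ih, Finset.sum_mul]
    exact Finset.sum_comm

end Term

/-- The four disciplines for the use of variables and of truth values. -/
inductive Kind
  | linear
  | affine
  | relevant
  | cartesian

/-- A term is linear (affine, relevant) if it uses every variable of its context exactly once
(at most once, at least once), and cartesian without restriction. -/
def Term.HasKind {S : Signature.{w}} {n : ℕ} (t : Term S n) : Kind → Prop
  | .linear => ∀ i, t.count i = 1
  | .affine => ∀ i, t.count i ≤ 1
  | .relevant => ∀ i, 1 ≤ t.count i
  | .cartesian => True

theorem Term.HasKind.op_var {S : Signature.{w}} (κ : Kind) (σ : S.Op) :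
    (Term.op σ Term.var : Term S (S.arity σ)).HasKind κ := by
  cases κ <;> simp [HasKind, count]

theorem Term.HasKind.translate {S T : Signature.{w}} {κ : Kind}
    {f : ∀ σ : S.Op, Term T (S.arity σ)} (hf : ∀ σ, (f σ).HasKind κ) {n : ℕ}
    {t : Term S n} (ht : t.HasKind κ) : (t.translate f).HasKind κ := by
  cases κ with
  | linear =>
    have key : ∀ (t : Term S n) i, (t.translate f).count i = t.count i := by
      intro t i
      induction t with
      | var k => rfl
      | op σ ts ih =>
        have h := hf σ
        simp only [HasKind] at h
        simp [Term.translate, count_subst, count, ih, h]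
    intro i
    rw [key]; exact ht i
  | affine =>
    have key : ∀ (t : Term S n) i, (t.translate f).count i ≤ t.count i := by
      intro t i
      induction t with
      | var k => rfl
      | op σ ts ih =>
        simp only [Term.translate, count_subst, count]
        refine Finset.sum_le_sum fun j _ => ?_
        calc _ ≤ 1 * (ts j).count i := Nat.mul_le_mul (hf σ j) (ih j)
          _ = _ := one_mul _
    intro i
    exact (key t i).trans (ht i)
  | relevant =>
    have key : ∀ (t : Term S n) i, t.count i ≤ (t.translate f).count i := by
      intro t i
      induction t with
      | var k => rfl
      | op σ ts ih =>
        simp only [Term.translate, count_subst, count]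
        refine Finset.sum_le_sum fun j _ => ?_
        calc _ = 1 * (ts j).count i := (one_mul _).symm
          _ ≤ _ := Nat.mul_le_mul (hf σ j) (ih j)
    intro i
    exact (ht i).trans (key t i)
  | cartesian => trivial

/-- A signature together with a set of equations between terms in finitely many variables. -/
structure Presentation extends Signature.{w} where
  /-- the equations -/
  eqs : ∀ {n : ℕ}, Term toSignature n → Term toSignature n → Prop

/-- Provability in equational logic from the equations of `P`. -/
inductive Provable (P : Presentation.{w}) :
    ∀ {n : ℕ}, Term P.toSignature n → Term P.toSignature n → Prop
  | ax {n m : ℕ} {s t : Term P.toSignature n} (h : P.eqs s t)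
      (r : Fin n → Term P.toSignature m) : Provable P (s.subst r) (t.subst r)
  | refl {n : ℕ} (t : Term P.toSignature n) : Provable P t t
  | symm {n : ℕ} {s t : Term P.toSignature n} : Provable P s t → Provable P t s
  | trans {n : ℕ} {s t r : Term P.toSignature n} :
      Provable P s t → Provable P t r → Provable P s r
  | congr {n : ℕ} (σ : P.Op) {ss ts : Fin (P.arity σ) → Term P.toSignature n} :
      (∀ j, Provable P (ss j) (ts j)) → Provable P (.op σ ss) (.op σ ts)

theorem Provable.subst {P : Presentation.{w}} {n m : ℕ} {s t : Term P.toSignature n}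
    (h : Provable P s t) (r : Fin n → Term P.toSignature m) :
    Provable P (s.subst r) (t.subst r) := by
  induction h with
  | ax h q => rw [Term.subst_subst, Term.subst_subst]; exact .ax h _
  | refl t => exact .refl _
  | symm _ ih => exact (ih r).symm
  | trans _ _ ih₁ ih₂ => exact (ih₁ r).trans (ih₂ r)
  | congr σ _ ih => exact .congr σ fun j => ih j r

theorem Provable.subst_congr {P : Presentation.{w}} {n m : ℕ} (t : Term P.toSignature n)
    {r q : Fin n → Term P.toSignature m} (h : ∀ i, Provable P (r i) (q i)) :
    Provable P (t.subst r) (t.subst q) := by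
  induction t with
  | var i => exact h i
  | op σ ts ih => exact .congr σ ih

/-- An interpretation of kind `κ`: operation symbols are sent to derived terms of the same
arity, all of kind `κ`, such that the translated equations are provable. -/
@[ext]
structure Interpretation (κ : Kind) (P R : Presentation.{w}) where
  /-- the derived term assigned to an operation symbol -/
  term : ∀ σ : P.Op, Term R.toSignature (P.arity σ)
  hasKind : ∀ σ, (term σ).HasKind κ
  provable : ∀ {n : ℕ} {s t : Term P.toSignature n}, P.eqs s t →
    Provable R (s.translate term) (t.translate term)

theorem Interpretation.translate_provable {κ : Kind} {P R : Presentation.{w}}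
    (i : Interpretation κ P R) {n : ℕ} {s t : Term P.toSignature n} (h : Provable P s t) :
    Provable R (s.translate i.term) (t.translate i.term) := by
  induction h with
  | ax h r => rw [Term.translate_subst, Term.translate_subst]; exact (i.provable h).subst _
  | refl t => exact .refl _
  | symm _ ih => exact ih.symm
  | trans _ _ ih₁ ih₂ => exact ih₁.trans ih₂
  | congr σ _ ih => exact Provable.subst_congr _ ih

/-- The category of signatures with equations and interpretations of kind `κ`. -/
structure SigCat (κ : Kind) where
  /-- the underlying signature with equations -/
  pres : Presentation.{w}

instance (κ : Kind) : Category (SigCat.{w} κ) where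
  Hom P R := Interpretation κ P.pres R.pres
  id P :=
    { term := fun σ => .op σ .var
      hasKind := fun σ => Term.HasKind.op_var κ σ
      provable := fun {n s t} h => by
        rw [Term.translate_id, Term.translate_id]
        have := Provable.ax h (Term.var (S := P.pres.toSignature))
        rwa [Term.subst_var, Term.subst_var] at this }
  comp i j :=
    { term := fun σ => (i.term σ).translate j.term
      hasKind := fun σ => Term.HasKind.translate j.hasKind (i.hasKind σ)
      provable := fun h => by
        rw [← Term.translate_translate, ← Term.translate_translate]
        exact j.translate_provable (i.provable h) }
  id_comp i := by
    apply Interpretation.ext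
    funext σ
    exact Term.subst_var _
  comp_id i := by
    apply Interpretation.ext
    funext σ
    exact Term.translate_id _
  assoc i j k := by
    apply Interpretation.ext
    funext σ
    exact Term.translate_translate _ _ _

/-! ### Algebras in a topos -/

section Algebras

variable {E : Type u} [Category.{v} E] [HasFiniteLimits E]

/-- The `n`-th power of an object. -/
abbrev power (A : E) (n : ℕ) : E := ∏ᶜ fun _ : Fin n => A

/-- A structure for a signature in `E`: an object with a morphism `Aⁿ ⟶ A` for every `n`-ary
operation symbol. -/
structure SigStructure (E : Type u) [Category.{v} E] [HasFiniteLimits E]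
    (S : Signature.{w}) where
  /-- the underlying object -/
  carrier : E
  /-- the interpretation of the operation symbols -/
  op : ∀ σ : S.Op, power carrier (S.arity σ) ⟶ carrier

namespace SigStructure

/-- The derived operation of a term. -/
def eval {S : Signature.{w}} (A : SigStructure E S) {n : ℕ} :
    Term S n → (power A.carrier n ⟶ A.carrier)
  | .var i => Pi.π (fun _ : Fin n => A.carrier) i
  | .op σ ts => Pi.lift (fun j => A.eval (ts j)) ≫ A.op σ

/-- The structure whose operations are the derived operations of given terms. -/
def reduct {S T : Signature.{w}} (f : ∀ σ : S.Op, Term T (S.arity σ)) (A : SigStructure E T) :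
    SigStructure E S where
  carrier := A.carrier
  op σ := A.eval (f σ)

/-- The value `σ(a_1, …, a_n)` at generalized elements. -/
def opApp {S : Signature.{w}} (A : SigStructure E S) (σ : S.Op) {X : E}
    (a : Fin (S.arity σ) → (X ⟶ A.carrier)) : X ⟶ A.carrier := Pi.lift a ≫ A.op σ

/-- The value `t(a_0, …, a_{n-1})` at generalized elements. -/
def app {S : Signature.{w}} (A : SigStructure E S) {n : ℕ} (t : Term S n) {X : E}
    (a : Fin n → (X ⟶ A.carrier)) : X ⟶ A.carrier := Pi.lift a ≫ A.eval t

variable [CartesianMonoidalCategory E]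

/-- Product structure with componentwise operations, on the chosen product. -/
abbrev prod {S : Signature.{w}} (A B : SigStructure E S) : SigStructure E S where
  carrier := A.carrier ⊗ B.carrier
  op σ := lift
    (Pi.lift (fun j => Pi.π (fun _ => A.carrier ⊗ B.carrier) j ≫ fst _ _) ≫ A.op σ)
    (Pi.lift (fun j => Pi.π (fun _ => A.carrier ⊗ B.carrier) j ≫ snd _ _) ≫ B.op σ)

/-- The structure on the chosen terminal object. -/
abbrev terminal (E : Type u) [Category.{v} E] [HasFiniteLimits E] [CartesianMonoidalCategory E]
    (S : Signature.{w}) : SigStructure E S where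
  carrier := 𝟙_ E
  op _ := toUnit _

theorem opApp_prod {S : Signature.{w}} (A B : SigStructure E S) (σ : S.Op) {X : E}
    (a : Fin (S.arity σ) → (X ⟶ A.carrier ⊗ B.carrier)) :
    (A.prod B).opApp σ a =
      lift (A.opApp σ fun j => a j ≫ fst _ _) (B.opApp σ fun j => a j ≫ snd _ _) := by
  have e₁ : Pi.lift a ≫ Pi.lift (fun j => Pi.π (fun _ => A.carrier ⊗ B.carrier) j ≫ fst _ _) =
      Pi.lift (fun j => a j ≫ fst _ _) := by
    apply Pi.hom_ext; intro j; simp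
  have e₂ : Pi.lift a ≫ Pi.lift (fun j => Pi.π (fun _ => A.carrier ⊗ B.carrier) j ≫ snd _ _) =
      Pi.lift (fun j => a j ≫ snd _ _) := by
    apply Pi.hom_ext; intro j; simp
  unfold opApp
  rw [← e₁, ← e₂, assoc, assoc]
  exact comp_lift _ _ _

theorem prod_eval {S : Signature.{w}} (A B : SigStructure E S) {n : ℕ} (t : Term S n) :
    (A.prod B).eval t = lift
      (Pi.lift (fun j => Pi.π (fun _ => A.carrier ⊗ B.carrier) j ≫ fst _ _) ≫ A.eval t)
      (Pi.lift (fun j => Pi.π (fun _ => A.carrier ⊗ B.carrier) j ≫ snd _ _) ≫ B.eval t) := by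
  induction t with
  | var i => apply hom_ext <;> simp [eval, prod]
  | op σ ts ih =>
    have h := opApp_prod A B σ (fun j => (A.prod B).eval (ts j))
    refine h.trans ?_
    simp only [ih, eval, opApp]
    congr 1 <;> rw [← assoc] <;> congr 1 <;> apply Pi.hom_ext <;> intro j
    · rw [Pi.lift_π, assoc, Pi.lift_π]
      exact lift_fst _ _
    · rw [Pi.lift_π, assoc, Pi.lift_π]
      exact lift_snd _ _

/-- A homomorphism of structures. -/
def IsHom {S : Signature.{w}} (A B : SigStructure E S) (f : A.carrier ⟶ B.carrier) : Prop :=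
  ∀ (σ : S.Op) {X : E} (a : Fin (S.arity σ) → (X ⟶ A.carrier)),
    A.opApp σ a ≫ f = B.opApp σ fun j => a j ≫ f

theorem comp_opApp {S : Signature.{w}} (A : SigStructure E S) (σ : S.Op) {X Y : E}
    (y : Y ⟶ X) (a : Fin (S.arity σ) → (X ⟶ A.carrier)) :
    y ≫ A.opApp σ a = A.opApp σ fun j => y ≫ a j := by
  unfold opApp
  rw [← assoc]
  congr 1
  apply Pi.hom_ext
  intro j
  simp

theorem isHom_associator {S : Signature.{w}} (A B C : SigStructure E S) :
    ((A.prod B).prod C).IsHom (A.prod (B.prod C)) (α_ A.carrier B.carrier C.carrier).hom := by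
  intro σ X a
  have h₁ := opApp_prod (A.prod B) C σ a
  have h₂ := opApp_prod A B σ (fun j => a j ≫ fst (A.carrier ⊗ B.carrier) C.carrier)
  have h₃ := opApp_prod A (B.prod C) σ
    (fun j => a j ≫ (α_ A.carrier B.carrier C.carrier).hom)
  have h₄ := opApp_prod B C σ
    (fun j => (a j ≫ (α_ A.carrier B.carrier C.carrier).hom) ≫
      snd A.carrier (B.carrier ⊗ C.carrier))
  refine (congrArg (· ≫ (α_ A.carrier B.carrier C.carrier).hom)
    (h₁.trans (congrArg (lift · _) h₂))).trans
    (Eq.trans ?_ (h₃.trans (congrArg (lift _ ·) h₄)).symm)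
  simp

theorem isHom_leftUnitor {S : Signature.{w}} (A : SigStructure E S) :
    ((terminal E S).prod A).IsHom A (λ_ A.carrier).hom := by
  intro σ X a
  refine (congrArg (· ≫ (λ_ A.carrier).hom) (opApp_prod (terminal E S) A σ a)).trans ?_
  rw [leftUnitor_hom]
  exact lift_snd _ _

theorem isHom_rightUnitor {S : Signature.{w}} (A : SigStructure E S) :
    (A.prod (terminal E S)).IsHom A (ρ_ A.carrier).hom := by
  intro σ X a
  refine (congrArg (· ≫ (ρ_ A.carrier).hom) (opApp_prod A (terminal E S) σ a)).trans ?_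
  rw [rightUnitor_hom]
  exact lift_fst _ _

end SigStructure

/-- A `(Σ, E)`-algebra in the topos: a structure satisfying the equations. -/
structure Algebra (E : Type u) [Category.{v} E] [HasFiniteLimits E]
    (P : Presentation.{w}) extends SigStructure E P.toSignature where
  sat : ∀ {n : ℕ} {s t : Term P.toSignature n}, P.eqs s t →
    toSigStructure.eval s = toSigStructure.eval t

variable [CartesianMonoidalCategory E]

/-- The product of algebras. -/
abbrev Algebra.prod {P : Presentation.{w}} (A B : Algebra E P) : Algebra E P where
  toSigStructure := A.toSigStructure.prod B.toSigStructure
  sat h := by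
    rw [SigStructure.prod_eval, SigStructure.prod_eval, A.sat h, B.sat h]

/-- The terminal algebra. -/
abbrev Algebra.terminal (E : Type u) [Category.{v} E] [HasFiniteLimits E]
    [CartesianMonoidalCategory E] (P : Presentation.{w}) : Algebra E P where
  toSigStructure := SigStructure.terminal E P.toSignature
  sat _ := toUnit_unique _ _

end Algebras

/-! ### Algebraic `Q`-relations -/

section AlgebraicRelations

variable {E : Type u} [Category.{v} E] [CartesianMonoidalCategory E] [BraidedCategory E]
  [HasFiniteLimits E] [MonoidalClosed E] [HasSubobjectClassifier E]
variable {Q : E} [MonObj Q] [IsCommMonObj Q] [InternalQuantale Q]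

/-- A `Q`-relation between structures is algebraic if internally
`R(a₁, b₁) ⊗ ⋯ ⊗ R(aₙ, bₙ) ≤ R(σ(a₁, …, aₙ), σ(b₁, …, bₙ))` for every operation symbol. -/
def IsAlgebraic {S : Signature.{w}} (A B : SigStructure E S)
    (R : A.carrier ⊗ B.carrier ⟶ Q) : Prop :=
  ∀ (σ : S.Op) {X : E} (a : Fin (S.arity σ) → (X ⟶ A.carrier))
    (b : Fin (S.arity σ) → (X ⟶ B.carrier)),
    ∏ j, ev R (a j) (b j) ≤ ev R (A.opApp σ a) (B.opApp σ b)

/-- `R` is affine if internally `R(a₁, b₁) ⊗ R(a₂, b₂) ≤ R(a₁, b₁)`. -/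
def IsAffine {A B : E} (R : A ⊗ B ⟶ Q) : Prop :=
  ∀ {X : E} (a₁ a₂ : X ⟶ A) (b₁ b₂ : X ⟶ B), ev R a₁ b₁ * ev R a₂ b₂ ≤ ev R a₁ b₁

/-- `R` is relevant if internally `R(a, b) ≤ R(a, b) ⊗ R(a, b)`. -/
def IsRelevant {A B : E} (R : A ⊗ B ⟶ Q) : Prop :=
  ∀ {X : E} (a : X ⟶ A) (b : X ⟶ B), ev R a b ≤ ev R a b * ev R a b

/-- Linear relations are arbitrary; cartesian relations are both affine and relevant. -/
def RelHasKind {A B : E} (R : A ⊗ B ⟶ Q) : Kind → Prop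
  | .linear => True
  | .affine => IsAffine R
  | .relevant => IsRelevant R
  | .cartesian => IsAffine R ∧ IsRelevant R

theorem RelHasKind.of_closure {A B C D : E} {R : A ⊗ B ⟶ Q} {S : C ⊗ D ⟶ Q}
    (ha : IsAffine R → IsAffine S) (hr : IsRelevant R → IsRelevant S) {κ : Kind}
    (h : RelHasKind R κ) : RelHasKind S κ := by
  cases κ with
  | linear => trivial
  | affine => exact ha h
  | relevant => exact hr h
  | cartesian => exact ⟨ha h.1, hr h.2⟩

theorem RelHasKind.of_closure₂ {A B C D F G : E} {R : A ⊗ B ⟶ Q} {R' : C ⊗ D ⟶ Q}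
    {S : F ⊗ G ⟶ Q} (ha : IsAffine R → IsAffine R' → IsAffine S)
    (hr : IsRelevant R → IsRelevant R' → IsRelevant S) {κ : Kind}
    (h : RelHasKind R κ) (h' : RelHasKind R' κ) : RelHasKind S κ := by
  cases κ with
  | linear => trivial
  | affine => exact ha h h'
  | relevant => exact hr h h'
  | cartesian => exact ⟨ha h.1 h'.1, hr h.2 h'.2⟩

theorem graphRel_hasKind {A B : E} (f : A ⟶ B) (κ : Kind) :
    RelHasKind (graphRel Q f) κ := by
  have ha : IsAffine (graphRel Q f) := by
    intro X a₁ a₂ b₁ b₂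
    simp only [ev_graphRel]
    rw [mul_idRel_le_iff]
    exact fun z _ => le_rfl
  have hr : IsRelevant (graphRel Q f) := by
    intro X a b
    simp only [ev_graphRel]
    rw [idRel_le_iff]
    intro Z z hz
    rw [MonObj.comp_mul, comp_ev, hz]
    calc (1 : Z ⟶ Q) = 1 * 1 := (one_mul 1).symm
      _ ≤ _ := mul_mono (one_le_idRel _) (one_le_idRel _)
  cases κ with
  | linear => trivial
  | affine => exact @ha
  | relevant => exact @hr
  | cartesian => exact ⟨@ha, @hr⟩

theorem compRel_hasKind {A B C : E} {R : A ⊗ B ⟶ Q} {S : B ⊗ C ⟶ Q} {κ : Kind}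
    (hR : RelHasKind R κ) (hS : RelHasKind S κ) : RelHasKind (compRel R S) κ := by
  have le_comp : ∀ {X : E} (a : X ⟶ A) (b : X ⟶ B) (c : X ⟶ C),
      ev R a b * ev S b c ≤ ev (compRel R S) a c := by
    intro X a b c
    have := (compRel_le_iff R S a c _).1 le_rfl (𝟙 X) b
    simpa using this
  refine RelHasKind.of_closure₂ ?_ ?_ hR hS
  · intro h₁ h₂ X a₁ a₂ c₁ c₂
    rw [mul_compRel_le_iff]
    intro Z z b₂
    rw [comp_ev, mul_comm, mul_compRel_le_iff]
    intro W w b₁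
    rw [MonObj.comp_mul, comp_ev, comp_ev, comp_ev, mul_comm, mul_mul_mul_comm]
    exact (mul_mono (h₁ _ _ _ _) (h₂ _ _ _ _)).trans (le_comp _ _ _)
  · intro h₁ h₂ X a c
    rw [compRel_le_iff]
    intro Z z b
    refine (mul_mono (h₁ _ _) (h₂ _ _)).trans ?_
    rw [mul_mul_mul_comm, MonObj.comp_mul, comp_ev]
    exact mul_mono (le_comp _ _ _) (le_comp _ _ _)

theorem tensorRel_hasKind {A B A' B' : E} {R : A ⊗ B ⟶ Q} {R' : A' ⊗ B' ⟶ Q} {κ : Kind}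
    (hR : RelHasKind R κ) (hR' : RelHasKind R' κ) : RelHasKind (tensorRel R R') κ := by
  refine RelHasKind.of_closure₂ ?_ ?_ hR hR'
  · intro h h' X a₁ a₂ b₁ b₂
    simp only [ev_tensorRel]
    rw [mul_mul_mul_comm]
    exact mul_mono (h _ _ _ _) (h' _ _ _ _)
  · intro h h' X a b
    simp only [ev_tensorRel]
    rw [mul_mul_mul_comm]
    exact mul_mono (h _ _) (h' _ _)

theorem prod_mono {n : ℕ} {X : E} {p q : Fin n → (X ⟶ Q)} (h : ∀ j, p j ≤ q j) :
    ∏ j, p j ≤ ∏ j, q j := by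
  induction n with
  | zero => simp
  | succ n ih =>
    rw [Fin.prod_univ_succ, Fin.prod_univ_succ]
    exact mul_mono (h 0) (ih fun j => h j.succ)

theorem comp_prod {n : ℕ} {X Y : E} (y : Y ⟶ X) (p : Fin n → (X ⟶ Q)) :
    y ≫ ∏ j, p j = ∏ j, y ≫ p j := by
  induction n with
  | zero => simp [MonObj.comp_one]
  | succ n ih => rw [Fin.prod_univ_succ, Fin.prod_univ_succ, MonObj.comp_mul, ih]

theorem mul_prod_idRel_le_iff {n : ℕ} {A X : E} (a b : Fin n → (X ⟶ A)) (u t : X ⟶ Q) :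
    u * ∏ j, ev (idRel Q A) (a j) (b j) ≤ t ↔
      ∀ {Z : E} (z : Z ⟶ X), (∀ j, z ≫ a j = z ≫ b j) → z ≫ u ≤ z ≫ t := by
  induction n generalizing u with
  | zero =>
    simp only [Finset.univ_eq_empty, Finset.prod_empty, mul_one]
    exact ⟨fun h Z z _ => comp_mono h z, fun h => by simpa using h (𝟙 X) (fun j => j.elim0)⟩
  | succ n ih =>
    rw [Fin.prod_univ_succ, ← mul_assoc, ih (fun j => a j.succ) (fun j => b j.succ)]
    constructor
    · intro h Z z hz
      refine le_trans ?_ (h z fun j => hz j.succ)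
      rw [MonObj.comp_mul, comp_ev, hz 0]
      calc z ≫ u = (z ≫ u) * 1 := (mul_one _).symm
        _ ≤ _ := mul_mono le_rfl (one_le_idRel _)
    · intro h Z z hz
      rw [MonObj.comp_mul, comp_ev, mul_idRel_le_iff]
      intro W w hw
      have := h (w ≫ z) (Fin.cases (by simpa using hw) fun j => by
        have := w ≫= hz j
        simpa using this)
      simpa using this

theorem mul_prod_compRel_le_iff {n : ℕ} {A B C X : E} (R : A ⊗ B ⟶ Q) (S : B ⊗ C ⟶ Q)
    (a : Fin n → (X ⟶ A)) (c : Fin n → (X ⟶ C)) (u t : X ⟶ Q) :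
    u * ∏ j, ev (compRel R S) (a j) (c j) ≤ t ↔
      ∀ {Z : E} (z : Z ⟶ X) (b : Fin n → (Z ⟶ B)),
        (z ≫ u) * ∏ j, (ev R (z ≫ a j) (b j) * ev S (b j) (z ≫ c j)) ≤ z ≫ t := by
  induction n generalizing X with
  | zero =>
    simp only [Finset.univ_eq_empty, Finset.prod_empty, mul_one]
    exact ⟨fun h Z z _ => comp_mono h z, fun h => by simpa using h (𝟙 X) (fun j => j.elim0)⟩
  | succ n ih =>
    rw [Fin.prod_univ_succ, ← mul_assoc, ih (fun j => a j.succ) (fun j => c j.succ)]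
    constructor
    · intro h Z z b
      rw [Fin.prod_univ_succ, ← mul_assoc]
      refine le_trans (mul_mono ?_ le_rfl) (h z fun j => b j.succ)
      rw [MonObj.comp_mul, comp_ev]
      have := (mul_compRel_le_iff R S (z ≫ a 0) (z ≫ c 0) (z ≫ u) _).1 le_rfl (𝟙 Z) (b 0)
      simpa using this
    · intro h Z z b
      rw [MonObj.comp_mul, comp_ev, mul_right_comm, mul_compRel_le_iff]
      intro W w b₀
      have := h (w ≫ z) (Fin.cons b₀ fun j => w ≫ b j)
      rw [Fin.prod_univ_succ] at this
      rw [MonObj.comp_mul, comp_prod, mul_right_comm, mul_assoc]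
      simpa [MonObj.comp_mul, comp_ev] using this

theorem graphRel_isAlgebraic {S : Signature.{w}} {A B : SigStructure E S}
    {f : A.carrier ⟶ B.carrier} (hf : A.IsHom B f) :
    IsAlgebraic A B (graphRel Q f) := by
  intro σ X a b
  simp only [ev_graphRel]
  have := mul_prod_idRel_le_iff (Q := Q) (fun j => a j ≫ f) b 1
    (ev (idRel Q B.carrier) (A.opApp σ a ≫ f) (B.opApp σ b))
  rw [one_mul] at this
  rw [this]
  intro Z z hz
  rw [comp_ev, MonObj.comp_one, hf σ a, SigStructure.comp_opApp, SigStructure.comp_opApp]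
  simp only [hz]
  exact one_le_idRel _

theorem compRel_isAlgebraic {S : Signature.{w}} {A B C : SigStructure E S}
    {R : A.carrier ⊗ B.carrier ⟶ Q} {T : B.carrier ⊗ C.carrier ⟶ Q}
    (hR : IsAlgebraic A B R) (hT : IsAlgebraic B C T) :
    IsAlgebraic A C (compRel R T) := by
  intro σ X a c
  have := mul_prod_compRel_le_iff R T a c 1
    (ev (compRel R T) (A.opApp σ a) (C.opApp σ c))
  rw [one_mul] at this
  rw [this]
  intro Z z b
  rw [MonObj.comp_one, one_mul, Finset.prod_mul_distrib, comp_ev, SigStructure.comp_opApp,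
    SigStructure.comp_opApp]
  refine (mul_mono (hR σ _ _) (hT σ _ _)).trans ?_
  have := (compRel_le_iff R T (A.opApp σ fun j => z ≫ a j) (C.opApp σ fun j => z ≫ c j) _).1
    le_rfl (𝟙 Z) (B.opApp σ b)
  simpa using this

theorem tensorRel_isAlgebraic {S : Signature.{w}} {A B A' B' : SigStructure E S}
    {R : A.carrier ⊗ B.carrier ⟶ Q} {R' : A'.carrier ⊗ B'.carrier ⟶ Q}
    (hR : IsAlgebraic A B R) (hR' : IsAlgebraic A' B' R') :
    IsAlgebraic (A.prod A') (B.prod B') (tensorRel R R') := by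
  intro σ X a b
  have h : ∀ j, ev (tensorRel R R') (a j) (b j) =
      ev R (a j ≫ fst _ _) (b j ≫ fst _ _) * ev R' (a j ≫ snd _ _) (b j ≫ snd _ _) :=
    fun j => ev_tensorRel R R' (a j) (b j)
  refine le_of_eq_of_le ((Finset.prod_congr rfl fun j _ => h j).trans
    Finset.prod_mul_distrib) ?_
  refine le_of_le_of_eq (mul_mono (hR σ _ _) (hR' σ _ _)) ?_
  refine Eq.symm ((congrArg₂ (fun x y => ev (tensorRel R R') x y)
    (SigStructure.opApp_prod A A' σ a) (SigStructure.opApp_prod B B' σ b)).trans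
    ((ev_tensorRel R R' _ _).trans ?_))
  simp only [lift_fst, lift_snd]

/-- The objects of the category of algebraic `Q`-relations of kind `κ`: the algebras. -/
structure AlgRel (Q : E) (κ : Kind) (P : Presentation.{w}) where
  /-- the underlying algebra -/
  alg : Algebra E P

/-- A morphism is an algebraic `Q`-relation of kind `κ` between the algebras. -/
@[ext]
structure AlgRel.Hom {κ : Kind} {P : Presentation.{w}} (A B : AlgRel Q κ P) where
  /-- the underlying `Q`-relation -/
  rel : A.alg.carrier ⊗ B.alg.carrier ⟶ Q
  isAlgebraic : IsAlgebraic A.alg.toSigStructure B.alg.toSigStructure rel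
  hasKind : RelHasKind rel κ

namespace AlgRel

variable {κ : Kind} {P : Presentation.{w}}

/-- The graph of a homomorphism of algebras. -/
def graph {A B : AlgRel Q κ P} (f : A.alg.carrier ⟶ B.alg.carrier)
    (hf : A.alg.IsHom B.alg.toSigStructure f) : Hom A B where
  rel := graphRel Q f
  isAlgebraic := graphRel_isAlgebraic hf
  hasKind := graphRel_hasKind f κ

theorem isHom_id (A : SigStructure E P.toSignature) : A.IsHom A (𝟙 _) := by
  intro σ X a
  simp only [comp_id]

/-- The category of algebraic `Q`-relations of kind `κ` over the signature with equations `P`,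
with identities and composition those of `Q`-relations. -/
instance : Category (AlgRel Q κ P) where
  Hom := Hom
  id A :=
    { rel := idRel Q A.alg.carrier
      isAlgebraic := graphRel_id (Q := Q) A.alg.carrier ▸ graphRel_isAlgebraic (isHom_id _)
      hasKind := graphRel_id (Q := Q) A.alg.carrier ▸ graphRel_hasKind _ κ }
  comp R S :=
    { rel := compRel R.rel S.rel
      isAlgebraic := compRel_isAlgebraic R.isAlgebraic S.isAlgebraic
      hasKind := compRel_hasKind R.hasKind S.hasKind }
  id_comp R := Hom.ext (id_compRel R.rel)
  comp_id R := Hom.ext (compRel_id R.rel)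
  assoc R S T := Hom.ext (compRel_assoc R.rel S.rel T.rel)

/-- The forgetful functor to `Q`-relations: underlying objects, and the same relations. -/
def forget (Q : E) [MonObj Q] [IsCommMonObj Q] [InternalQuantale Q] (κ : Kind)
    (P : Presentation.{w}) : AlgRel Q κ P ⥤ RelObj Q where
  obj A := ⟨A.alg.carrier⟩
  map R := R.rel

instance : (forget Q κ P).Faithful where
  map_injective h := Hom.ext h

/-- The graph of an isomorphism of algebras. -/
def graphIso {A B : AlgRel Q κ P} (e : A.alg.carrier ≅ B.alg.carrier)
    (h : A.alg.IsHom B.alg.toSigStructure e.hom) : A ≅ B where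
  hom := graph e.hom h
  inv := graph e.inv (fun σ X a => by
    rw [← cancel_mono e.hom, assoc, e.inv_hom_id, comp_id, h]
    simp)
  hom_inv_id := Hom.ext (QRel.graphIso (Q := Q) e).hom_inv_id
  inv_hom_id := Hom.ext (QRel.graphIso (Q := Q) e).inv_hom_id

/-- The tensor product is the product of algebras and the unit the terminal algebra; tensor
products of morphisms and coherence isomorphisms are those of `Q`-relations. -/
instance : MonoidalCategoryStruct (AlgRel Q κ P) where
  tensorObj A B := ⟨A.alg.prod B.alg⟩
  tensorUnit := ⟨Algebra.terminal E P⟩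
  tensorHom R S :=
    { rel := tensorRel R.rel S.rel
      isAlgebraic := tensorRel_isAlgebraic R.isAlgebraic S.isAlgebraic
      hasKind := tensorRel_hasKind R.hasKind S.hasKind }
  whiskerLeft A _ _ R :=
    { rel := tensorRel (idRel Q A.alg.carrier) R.rel
      isAlgebraic := tensorRel_isAlgebraic (Hom.isAlgebraic (𝟙 A)) R.isAlgebraic
      hasKind := tensorRel_hasKind (Hom.hasKind (𝟙 A)) R.hasKind }
  whiskerRight R A :=
    { rel := tensorRel R.rel (idRel Q A.alg.carrier)
      isAlgebraic := tensorRel_isAlgebraic R.isAlgebraic (Hom.isAlgebraic (𝟙 A))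
      hasKind := tensorRel_hasKind R.hasKind (Hom.hasKind (𝟙 A)) }
  associator A B C := graphIso (α_ A.alg.carrier B.alg.carrier C.alg.carrier) 
    (SigStructure.isHom_associator _ _ _)
  leftUnitor A := graphIso (λ_ A.alg.carrier) (SigStructure.isHom_leftUnitor _)
  rightUnitor A := graphIso (ρ_ A.alg.carrier) (SigStructure.isHom_rightUnitor _)

instance : MonoidalCategory (AlgRel Q κ P) := MonoidalCategory.ofTensorHom
  (id_tensorHom_id := fun A B => Hom.ext (tensorRel_id A.alg.carrier B.alg.carrier))
  (id_tensorHom := fun _ _ _ _ => rfl)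
  (tensorHom_id := fun _ _ => rfl)
  (tensorHom_comp_tensorHom := fun R R' S S' =>
    Hom.ext (tensorRel_comp R.rel S.rel R'.rel S'.rel))
  (associator_naturality := fun R₁ R₂ R₃ => Hom.ext (MonoidalCategory.associator_naturality
    ((forget Q κ P).map R₁) ((forget Q κ P).map R₂) ((forget Q κ P).map R₃)))
  (leftUnitor_naturality := fun R => Hom.ext
    (MonoidalCategory.leftUnitor_naturality ((forget Q κ P).map R)))
  (rightUnitor_naturality := fun R => Hom.ext
    (MonoidalCategory.rightUnitor_naturality ((forget Q κ P).map R)))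
  (pentagon := fun A B C D => Hom.ext (MonoidalCategory.pentagon ((forget Q κ P).obj A)
    ((forget Q κ P).obj B) ((forget Q κ P).obj C) ((forget Q κ P).obj D)))
  (triangle := fun A B => Hom.ext
    (MonoidalCategory.triangle ((forget Q κ P).obj A) ((forget Q κ P).obj B)))

end AlgRel

end AlgebraicRelations

/-- A strict monoidal functor: the unit object and tensor products of objects are preserved on
the nose, and `F` is a monoidal functor whose structure morphisms are the identities. -/
def IsStrictMonoidal {C : Type*} [Category* C] [MonoidalCategory C] {D : Type*} [Category* D]
    [MonoidalCategory D] (F : C ⥤ D) : Prop :=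
  ∃ (h₀ : 𝟙_ D = F.obj (𝟙_ C)) (h₂ : ∀ A B : C, F.obj A ⊗ F.obj B = F.obj (A ⊗ B))
    (_ : F.Monoidal), Functor.LaxMonoidal.ε F = eqToHom h₀ ∧
      ∀ A B : C, Functor.LaxMonoidal.μ F A B = eqToHom (h₂ A B)

end

end QRel

/-! The functor leaves carriers and relations untouched, so only two things carry weight: an
inequality for derived operations, which makes the functor well defined on morphisms, and equalities
between reducts of structures, which give strictness and functoriality.

For the inequality, induction on a term `t` gives, for every algebraic `R` of whatever kind, `∏
R(a_j, b_j) ^ count_j(t) ≤ R(t(a), t(b))` (`IsAlgebraic.prod_pow_count_le`); commutativity of `Q`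
allows the factors to be regrouped by variable. It remains to compare `∏ R(a_j, b_j)` with the
left-hand side. An exponent 1 needs nothing, and a larger exponent is reached by relevance. An
exponent 0 is the delicate case: the unit `k` need not be the top element, so `R(a_j, b_j)` cannot
simply be bounded by `k`. Affinity discards a value of `R` only next to another value of `R`. The
surplus factors are therefore kept until the induction has produced `R(t(a), t(b))`, which then
absorbs them one by one. This also covers terms in which no variable occurs.

For the structures, substitution of terms is composition of operations (`eval_subst`). Hence
evaluating a term in a reduct is evaluating its translation (`reduct_eval`); soundness of equational
logic then makes the reduct an algebra, and reducts compose on the nose. Derived operations on a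
product are componentwise, so reducts also commute on the nose with products and the terminal
structure. The comparison morphisms are thus transports along equalities that do not change the
carrier. Their underlying relations are identity relations, and the coherence laws reduce to the
unit laws for composition of relations. -/

namespace QRel

noncomputable section

/-! ### Derived operations, reducts and soundness of equational logic -/

section DerivedOperations

variable {E : Type u} [Category.{v} E] [HasFiniteLimits E]

namespace SigStructure

theorem app_var {S : Signature.{w}} (A : SigStructure E S) {n : ℕ} (i : Fin n) {X : E}
    (a : Fin n → (X ⟶ A.carrier)) : A.app (.var i) a = a i := by
  simp [app, eval]

theorem app_op {S : Signature.{w}} (A : SigStructure E S) {n : ℕ} (σ : S.Op)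
    (ts : Fin (S.arity σ) → Term S n) {X : E} (a : Fin n → (X ⟶ A.carrier)) :
    A.app (.op σ ts) a = A.opApp σ fun j => A.app (ts j) a := by
  unfold app opApp
  rw [eval, ← assoc]
  congr 1
  apply Pi.hom_ext
  intro j
  simp

/-- The substitution lemma: substituting terms amounts to composing their operations. Soundness and
the behaviour of reducts both rest on it. -/
theorem eval_subst {S : Signature.{w}} (A : SigStructure E S) {m n : ℕ}
    (s : Fin m → Term S n) (t : Term S m) :
    A.eval (t.subst s) = A.app t fun i => A.eval (s i) := by
  induction t with
  | var i => rw [app_var]; rfl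
  | op σ ts ih =>
    rw [app_op]
    simp only [← ih]
    rfl

theorem eval_op_var {S : Signature.{w}} (A : SigStructure E S) (σ : S.Op) :
    A.eval (.op σ .var) = A.op σ := by
  have h : Pi.lift (fun j => A.eval (.var j)) = 𝟙 (power A.carrier (S.arity σ)) := by
    apply Pi.hom_ext
    intro j
    simp [eval]
  rw [eval, h, id_comp]

/-- Translation and reduct make the same replacement, one in syntax and the other in operations.
This transfers the equations to the reduct and yields contravariance. -/
theorem reduct_eval {S T : Signature.{w}} (f : ∀ σ : S.Op, Term T (S.arity σ))
    (A : SigStructure E T) {n : ℕ} (t : Term S n) :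
    (A.reduct f).eval t = A.eval (t.translate f) := by
  induction t with
  | var i => rfl
  | op σ ts ih =>
    rw [Term.translate, eval_subst]
    simp only [← ih]
    rfl

/-- An equality of structures, not merely an isomorphism, because the carrier is the same object and
only the operations have to be compared. The same holds for the three reduct lemmas below. -/
theorem reduct_op_var {S : Signature.{w}} (A : SigStructure E S) :
    A.reduct (fun σ => .op σ .var) = A := by
  obtain ⟨X, op⟩ := A
  exact congrArg (SigStructure.mk X) (funext fun σ => eval_op_var ⟨X, op⟩ σ)

theorem reduct_reduct {S T U : Signature.{w}} (f : ∀ σ : S.Op, Term T (S.arity σ))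
    (g : ∀ σ : T.Op, Term U (T.arity σ)) (A : SigStructure E U) :
    (A.reduct g).reduct f = A.reduct fun σ => (f σ).translate g :=
  congrArg (SigStructure.mk A.carrier) (funext fun σ => reduct_eval g A (f σ))

variable [CartesianMonoidalCategory E]

theorem reduct_prod {S T : Signature.{w}} (f : ∀ σ : S.Op, Term T (S.arity σ))
    (A B : SigStructure E T) : (A.prod B).reduct f = (A.reduct f).prod (B.reduct f) :=
  congrArg (SigStructure.mk (A.carrier ⊗ B.carrier)) (funext fun σ => prod_eval A B (f σ))

theorem reduct_terminal {S T : Signature.{w}} (f : ∀ σ : S.Op, Term T (S.arity σ)) :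
    (terminal E T).reduct f = terminal E S :=
  congrArg (SigStructure.mk (𝟙_ E)) (funext fun _ => toUnit_unique _ _)

end SigStructure

/-- Soundness of equational logic, by induction on derivations. -/
theorem Algebra.eval_eq_of_provable {P : Presentation.{w}} (A : Algebra E P) {n : ℕ}
    {s t : Term P.toSignature n} (h : Provable P s t) : A.eval s = A.eval t := by
  induction h with
  -- A substitution instance of an axiom precomposes both sides with the same tuple of operations.
  | ax h r => rw [SigStructure.eval_subst, SigStructure.eval_subst, SigStructure.app, A.sat h]; rfl
  | refl t => rfl
  | symm _ ih => exact ih.symm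
  | trans _ _ ih₁ ih₂ => exact ih₁.trans ih₂
  | congr σ _ ih => simp only [SigStructure.eval, ih]

theorem Algebra.toSigStructure_injective {P : Presentation.{w}} {A B : Algebra E P}
    (h : A.toSigStructure = B.toSigStructure) : A = B := by
  cases A
  cases B
  cases h
  rfl

/-- The algebra on the same carrier whose operations are the derived operations given by an
interpretation. -/
def Algebra.ofInterpretation {κ : Kind} {P R : Presentation.{w}} (i : Interpretation κ P R)
    (A : Algebra E R) : Algebra E P where
  toSigStructure := A.toSigStructure.reduct i.term
  sat h := by
    rw [SigStructure.reduct_eval, SigStructure.reduct_eval]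
    exact A.eval_eq_of_provable (i.provable h)

end DerivedOperations

/-! ### Algebraic relations and derived operations -/

section Relations

variable {E : Type u} [Category.{v} E] [CartesianMonoidalCategory E] [BraidedCategory E]
  [HasFiniteLimits E] [MonoidalClosed E] [HasSubobjectClassifier E]
variable {Q : E} [MonObj Q] [IsCommMonObj Q] [InternalQuantale Q]

/-- Relevance duplicates one factor at a time. Exponent 0 is excluded, since `R(a, b) ≤ k` may fail.
-/
theorem IsRelevant.ev_le_pow {A B : E} {R : A ⊗ B ⟶ Q} (h : IsRelevant R) {X : E}
    (a : X ⟶ A) (b : X ⟶ B) {m : ℕ} (hm : 1 ≤ m) : ev R a b ≤ ev R a b ^ m := by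
  induction m, hm using Nat.le_induction with
  | base => rw [pow_one]
  | succ m _ ih =>
    rw [pow_succ]
    exact (h a b).trans (mul_mono ih le_rfl)

/-- Every term satisfies the algebraicity inequality, each variable being counted with its
multiplicity. -/
theorem IsAlgebraic.prod_pow_count_le {S : Signature.{w}} {A B : SigStructure E S}
    {R : A.carrier ⊗ B.carrier ⟶ Q} (hR : IsAlgebraic A B R) {n : ℕ} (t : Term S n) {X : E}
    (a : Fin n → (X ⟶ A.carrier)) (b : Fin n → (X ⟶ B.carrier)) :
    ∏ j, ev R (a j) (b j) ^ t.count j ≤ ev R (A.app t a) (B.app t b) := by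
  induction t with
  | var i =>
    rw [SigStructure.app_var, SigStructure.app_var]
    -- All exponents vanish except the one at `i`, so the product collapses to a single factor.
    simp [Term.count, pow_ite]
  | op σ ts ih =>
    rw [SigStructure.app_op, SigStructure.app_op]
    -- The exponent of a variable is the sum of its counts in the arguments. Splitting the power and
    -- exchanging the two products groups the factors by argument, which is the form the induction
    -- hypotheses need.
    simp only [Term.count, ← Finset.prod_pow_eq_pow_sum]
    rw [Finset.prod_comm]
    exact (prod_mono ih).trans (hR σ _ _)

/-- The element `r` survives each absorption unchanged, so it can swallow the factors in turn. -/
theorem mul_prod_le_of_mul_le {n : ℕ} {X : E} {r : X ⟶ Q} {q : Fin n → (X ⟶ Q)}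
    (h : ∀ j, r * q j ≤ r) : r * ∏ j, q j ≤ r := by
  induction n with
  | zero => simp
  | succ n ih =>
    rw [Fin.prod_univ_succ, ← mul_assoc]
    exact (mul_mono (h 0) le_rfl).trans (ih fun j => h j.succ)

/-- Algebraic relations of kind `κ` respect the derived operations of kind `κ`. -/
theorem IsAlgebraic.prod_le_app {S : Signature.{w}} {A B : SigStructure E S}
    {R : A.carrier ⊗ B.carrier ⟶ Q} (hR : IsAlgebraic A B R) {κ : Kind} (hκ : RelHasKind R κ)
    {n : ℕ} {t : Term S n} (ht : t.HasKind κ) {X : E}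
    (a : Fin n → (X ⟶ A.carrier)) (b : Fin n → (X ⟶ B.carrier)) :
    ∏ j, ev R (a j) (b j) ≤ ev R (A.app t a) (B.app t b) := by
  -- `q` is the part of the factor `R(a_j, b_j)` not consumed by the occurrences of the variable:
  -- the whole factor if the variable is unused, and 1 otherwise. The second condition says that the
  -- value of `R` at the term can absorb it.
  have key : ∀ j, ∃ q : X ⟶ Q, ev R (a j) (b j) ≤ ev R (a j) (b j) ^ t.count j * q ∧
      ev R (A.app t a) (B.app t b) * q ≤ ev R (A.app t a) (B.app t b) := by
    intro j
    have unused (ha : IsAffine R) (h : t.count j = 0) :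
        ∃ q : X ⟶ Q, ev R (a j) (b j) ≤ ev R (a j) (b j) ^ t.count j * q ∧
          ev R (A.app t a) (B.app t b) * q ≤ ev R (A.app t a) (B.app t b) :=
      -- Affinity is applied with the values of the term as the pair that is kept and `(a j, b j)`
      -- as the pair that is discarded.
      ⟨ev R (a j) (b j), by rw [h, pow_zero, one_mul], ha _ _ _ _⟩
    have used (h : ev R (a j) (b j) ≤ ev R (a j) (b j) ^ t.count j) :
        ∃ q : X ⟶ Q, ev R (a j) (b j) ≤ ev R (a j) (b j) ^ t.count j * q ∧
          ev R (A.app t a) (B.app t b) * q ≤ ev R (A.app t a) (B.app t b) :=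
      ⟨1, by rwa [mul_one], by rw [mul_one]⟩
    cases κ with
    | linear => exact used (by rw [ht j, pow_one])
    | affine =>
      rcases Nat.le_one_iff_eq_zero_or_eq_one.1 (ht j) with h | h
      · exact unused hκ h
      · exact used (by rw [h, pow_one])
    | relevant => exact used (IsRelevant.ev_le_pow hκ _ _ (ht j))
    | cartesian =>
      rcases Nat.eq_zero_or_pos (t.count j) with h | h
      · exact unused hκ.1 h
      · exact used (IsRelevant.ev_le_pow hκ.2 _ _ h)
  choose q hq hrq using key
  calc ∏ j, ev R (a j) (b j) ≤ ∏ j, (ev R (a j) (b j) ^ t.count j * q j) := prod_mono hq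
    _ = (∏ j, ev R (a j) (b j) ^ t.count j) * ∏ j, q j := Finset.prod_mul_distrib
    _ ≤ ev R (A.app t a) (B.app t b) * ∏ j, q j := mul_mono (hR.prod_pow_count_le t a b) le_rfl
    _ ≤ _ := mul_prod_le_of_mul_le hrq

/-! ### The functor induced by an interpretation -/

namespace AlgRel

variable {κ : Kind}

theorem alg_toSigStructure_injective {P : Presentation.{w}} {A B : AlgRel Q κ P}
    (h : A.alg.toSigStructure = B.alg.toSigStructure) : A = B :=
  congrArg AlgRel.mk (Algebra.toSigStructure_injective h)

/-- The functor between categories of algebraic relations induced by an interpretation. -/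
def reduct {P R : Presentation.{w}} (i : Interpretation κ P R) : AlgRel Q κ R ⥤ AlgRel Q κ P where
  obj A := ⟨A.alg.ofInterpretation i⟩
  map R :=
    { rel := R.rel
      -- In the reduct, `σ` acts as the derived operation of `i.term σ`, so algebraicity at `σ` is
      -- the derived-operation inequality for that term. Here the kind of the relation has to match
      -- that of the interpretation.
      isAlgebraic := fun σ _ a b => R.isAlgebraic.prod_le_app R.hasKind (i.hasKind σ) a b
      hasKind := R.hasKind }

/-- Functors into algebraic relations agree if they agree on structures and on underlying
relations. -/
theorem functor_ext {C : Type*} [Category* C] {P : Presentation.{w}} {F G : C ⥤ AlgRel Q κ P}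
    (h : ∀ X, (F.obj X).alg.toSigStructure = (G.obj X).alg.toSigStructure)
    (h' : F ⋙ forget Q κ P = G ⋙ forget Q κ P) : F = G := by
  refine CategoryTheory.Functor.ext (fun X => alg_toSigStructure_injective (h X)) fun X Y f => ?_
  -- After forgetting, the transports live between objects of `RelObj Q`, where the equality `h'` of
  -- functors supplies exactly the required conjugation.
  apply (forget Q κ P).map_injective
  rw [Functor.map_comp, Functor.map_comp, eqToHom_map, eqToHom_map]
  exact Functor.congr_hom h' f

/-- Transport along an equality of algebras sees only the carriers. The equality `hc` is a separate
argument so that it can be given as `rfl` when the carriers agree definitionally; the relation is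
then an identity. -/
theorem eqToHom_rel {P : Presentation.{w}} {A B : AlgRel Q κ P} (h : A = B)
    (hc : A.alg.carrier = B.alg.carrier) : (eqToHom h).rel = graphRel Q (eqToHom hc) := by
  subst h
  exact (graphRel_id _).symm

/-! ### Strict monoidality -/

theorem reduct_unit {P R : Presentation.{w}} (i : Interpretation κ P R) :
    𝟙_ (AlgRel Q κ P) = (reduct i).obj (𝟙_ (AlgRel Q κ R)) :=
  alg_toSigStructure_injective (SigStructure.reduct_terminal i.term).symm

theorem reduct_tensor {P R : Presentation.{w}} (i : Interpretation κ P R) (A B : AlgRel Q κ R) :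
    (reduct i).obj A ⊗ (reduct i).obj B = (reduct i).obj (A ⊗ B) :=
  alg_toSigStructure_injective (SigStructure.reduct_prod i.term _ _).symm

theorem eqToHom_reduct_unit_rel {P R : Presentation.{w}} (i : Interpretation κ P R) :
    (eqToHom (reduct_unit (Q := Q) i)).rel = idRel Q (𝟙_ E) :=
  (eqToHom_rel (reduct_unit (Q := Q) i) rfl).trans (graphRel_id _)

theorem eqToHom_reduct_tensor_rel {P R : Presentation.{w}} (i : Interpretation κ P R)
    (A B : AlgRel Q κ R) :
    (eqToHom (reduct_tensor i A B)).rel = idRel Q (A.alg.carrier ⊗ B.alg.carrier) :=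
  (eqToHom_rel (reduct_tensor i A B) rfl).trans (graphRel_id _)

/-- The monoidal structure of the reduct functor, with identities as structure morphisms. -/
def reductCoreMonoidal {P R : Presentation.{w}} (i : Interpretation κ P R) :
    (reduct (Q := Q) i).CoreMonoidal where
  εIso := eqToIso (reduct_unit i)
  μIso A B := eqToIso (reduct_tensor i A B)
  μIso_hom_natural_left {A B} f C := by
    apply Hom.ext
    change compRel (tensorRel f.rel (idRel Q C.alg.carrier)) (eqToHom (reduct_tensor i B C)).rel =
      compRel (eqToHom (reduct_tensor i A C)).rel (tensorRel f.rel (idRel Q C.alg.carrier))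
    rw [eqToHom_reduct_tensor_rel, eqToHom_reduct_tensor_rel]
    exact (compRel_id _).trans (id_compRel _).symm
  μIso_hom_natural_right {A B} C f := by
    apply Hom.ext
    change compRel (tensorRel (idRel Q C.alg.carrier) f.rel) (eqToHom (reduct_tensor i C B)).rel =
      compRel (eqToHom (reduct_tensor i C A)).rel (tensorRel (idRel Q C.alg.carrier) f.rel)
    rw [eqToHom_reduct_tensor_rel, eqToHom_reduct_tensor_rel]
    exact (compRel_id _).trans (id_compRel _).symm
  associativity A B C := by
    apply Hom.ext
    -- The reduct keeps the relation underlying the associator, so the same graph stands on both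
    -- sides, surrounded only by transports, which become identity relations.
    change compRel (tensorRel (eqToHom (reduct_tensor i A B)).rel (idRel Q C.alg.carrier))
        (compRel (eqToHom (reduct_tensor i (A ⊗ B) C)).rel
          (graphRel Q (α_ A.alg.carrier B.alg.carrier C.alg.carrier).hom)) =
      compRel (graphRel Q (α_ A.alg.carrier B.alg.carrier C.alg.carrier).hom)
        (compRel (tensorRel (idRel Q A.alg.carrier) (eqToHom (reduct_tensor i B C)).rel)
          (eqToHom (reduct_tensor i A (B ⊗ C))).rel)
    simp only [eqToHom_reduct_tensor_rel]
    refine (congrArg₂ compRel (tensorRel_id _ _) (id_compRel _)).trans ((id_compRel _).trans ?_)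
    exact ((congrArg (compRel _) ((compRel_id _).trans (tensorRel_id _ _))).trans
      (compRel_id _)).symm
  left_unitality A := by
    apply Hom.ext
    change graphRel Q (λ_ A.alg.carrier).hom =
      compRel (tensorRel (eqToHom (reduct_unit (Q := Q) i)).rel (idRel Q A.alg.carrier))
        (compRel (eqToHom (reduct_tensor i (𝟙_ _) A)).rel (graphRel Q (λ_ A.alg.carrier).hom))
    rw [eqToHom_reduct_tensor_rel, eqToHom_reduct_unit_rel]
    exact ((congrArg₂ compRel (tensorRel_id _ _) (id_compRel _)).trans (id_compRel _)).symm
  right_unitality A := by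
    apply Hom.ext
    change graphRel Q (ρ_ A.alg.carrier).hom =
      compRel (tensorRel (idRel Q A.alg.carrier) (eqToHom (reduct_unit (Q := Q) i)).rel)
        (compRel (eqToHom (reduct_tensor i A (𝟙_ _))).rel (graphRel Q (ρ_ A.alg.carrier).hom))
    rw [eqToHom_reduct_tensor_rel, eqToHom_reduct_unit_rel]
    exact ((congrArg₂ compRel (tensorRel_id _ _) (id_compRel _)).trans (id_compRel _)).symm

theorem reduct_isStrictMonoidal {P R : Presentation.{w}} (i : Interpretation κ P R) :
    IsStrictMonoidal (reduct (Q := Q) i) :=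
  ⟨reduct_unit i, reduct_tensor i, (reductCoreMonoidal i).toMonoidal, rfl, fun _ _ => rfl⟩

end AlgRel

end Relations

end

end QRel

/-! ### Assembly of the theorem -/

theorem mainTheorem7 {E : Type u} [Category.{v} E] [CartesianMonoidalCategory E]
    [BraidedCategory E] [HasFiniteLimits E] [MonoidalClosed E] [HasSubobjectClassifier E]
    (Q : E) [MonObj Q] [IsCommMonObj Q] [QRel.InternalQuantale Q] (κ : QRel.Kind) :
    (∃ star : ∀ {P₁ P₂ : QRel.SigCat.{w} κ}, (P₁ ⟶ P₂) →
        (QRel.AlgRel Q κ P₂.pres ⥤ QRel.AlgRel Q κ P₁.pres),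
      (∀ {P₁ P₂ : QRel.SigCat.{w} κ} (i : P₁ ⟶ P₂), QRel.IsStrictMonoidal (star i)) ∧
      (∀ {P₁ P₂ : QRel.SigCat.{w} κ} (i : P₁ ⟶ P₂) (A : QRel.AlgRel Q κ P₂.pres),
        ((star i).obj A).alg.toSigStructure = A.alg.reduct i.term) ∧
      (∀ {P₁ P₂ : QRel.SigCat.{w} κ} (i : P₁ ⟶ P₂),
        star i ⋙ QRel.AlgRel.forget Q κ P₁.pres = QRel.AlgRel.forget Q κ P₂.pres) ∧
      (∀ P : QRel.SigCat.{w} κ, star (𝟙 P) = 𝟭 (QRel.AlgRel Q κ P.pres)) ∧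
      (∀ {P₁ P₂ P₃ : QRel.SigCat.{w} κ} (i : P₁ ⟶ P₂) (j : P₂ ⟶ P₃),
        star (i ≫ j) = star j ⋙ star i)) ∧
    (∀ (P : QRel.Presentation.{w}) (A B : QRel.AlgRel Q κ P) (R : A ⟶ B) (n : ℕ)
      (t : QRel.Term P.toSignature n), t.HasKind κ →
      ∀ {X : E} (a : Fin n → (X ⟶ A.alg.carrier)) (b : Fin n → (X ⟶ B.alg.carrier)),
        ∏ j, QRel.ev R.rel (a j) (b j) ≤ QRel.ev R.rel (A.alg.app t a) (B.alg.app t b)) := by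
  refine ⟨⟨fun i => QRel.AlgRel.reduct i, fun i => QRel.AlgRel.reduct_isStrictMonoidal i,
    fun _ _ => rfl, fun _ => rfl, fun P => ?_, fun i j => ?_⟩,
    fun P A B R n t ht X a b => R.isAlgebraic.prod_le_app R.hasKind ht a b⟩
  -- On underlying relations both functors do nothing, so `rfl` settles that half here and in the
  -- composition law; only the structures have to be compared.
  · exact QRel.AlgRel.functor_ext (fun A => QRel.SigStructure.reduct_op_var _) rfl
  · exact QRel.AlgRel.functor_ext
      (fun A => (QRel.SigStructure.reduct_reduct i.term j.term _).symm) rfl
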